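/- Let $b\in\{N,D\}$ (Neumann or Dirichlet). Let $\mu$ and $\mu_n$ $(n\in\mathbb N)$ be non-atomic Borel probability measures on $[0,1]$ with $0,1\in\operatorname{supp}\mu$ and $0,1\in\operatorname{supp}\mu_n$ for all $n$, such that $\mu_n\rightharpoonup\mu$ weakly and $\operatorname{supp}\mu\subseteq\operatorname{supp}\mu_n$ for all $n$. For such a measure $\nu$, the Krein–Feller operator $\Delta_\nu^b$ on $L^2([0,1],\nu)$ (real-valued) is defined as follows: $u\in\mathcal D(\Delta_\nu^b)$ and $\Delta_\nu^b u=g\in L^2([0,1],\nu)$ if and only if $u$ has a representative $f\in C^1([0,1])$ with $f'(x)=f'(0)+\int_{[0,x]}g\,d\nu$ for all $x\in[0,1]$ and with $f'(0)=f'(1)=0$ if $b=N$, respectively $f(0)=f(1)=0$ if $b=D$. Let $(C[0,1])_\nu^b$ be the space of all $u\in L^2([0,1],\nu)$ that have a continuous representative (for $b=D$: a continuous representative vanishing at $0$ and $1$), normed by $\|u\|_\infty=\sup_{x\in\operatorname{supp}\nu}|\tilde u(x)|$, where $\tilde u$ is the continuous representative of $u$ that is linear on every interval in $[0,1]\setminus\operatorname{supp}\nu$.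 Let $\pi_n:(C[0,1])_\mu^b\to(C[0,1])_{\mu_n}^b$ send $u$ to the $L^2([0,1],\mu_n)$-class of the continuous representative $\tilde u$ of $u$ that is linear on every interval in $[0,1]\setminus\operatorname{supp}\mu$. Then $\Delta_\mu^b$ and each $\Delta_{\mu_n}^b$ are the infinitesimal generators of unique strongly continuous semigroups $(T_t^b)_{t\ge0}$ on $L^2([0,1],\mu)$ and $(T_{t,n}^b)_{t\ge0}$ on $L^2([0,1],\mu_n)$. They leave $(C[0,1])_\mu^b$, respectively $(C[0,1])_{\mu_n}^b$, invariant; denote the restrictions to these spaces by $\bar T_t^b$ and $\bar T_{t,n}^b$. For every $f\in(C[0,1])_\mu^b$ and every $S\ge0$, $$\lim_{n\to\infty}\ \sup_{0\le t\le S}\ \bigl\|\pi_n\bar T_t^b f-\bar T_{t,n}^b\,\pi_n f\bigr\|_\infty=0 .$$ -/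

import Mathlib

open MeasureTheory Filter Topology Set
open scoped NNReal ENNReal unitInterval

/-- The measures under consideration: non-atomic Borel probability measures on `[0,1]`
(points are null sets, by `NullSingletonClass`) whose support contains both end points. -/
class MassDistribution (μ : Measure I) : Prop extends IsProbabilityMeasure μ, NullSingletonClass μ where
  zero_mem_support : (0 : I) ∈ μ.support
  one_mem_support : (1 : I) ∈ μ.support

/-- The two boundary conditions `N` and `D`. -/
inductive BoundaryCondition where
  | neumann
  | dirichlet

/-- The Hilbert space `L²([0,1], μ)`. -/
abbrev L2 (μ : Measure I) := Lp ℝ 2 μ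

section KreinFeller

/-- `f` is of class `C¹` on `[0,1]` and `f'` has the `μ`-derivative `g`, that is
`f'(x) = f'(0) + ∫_{[0,x]} g dμ` for all `x ∈ [0,1]` (only the values of `f` on `[0,1]` matter). -/
def HasSecondMuDeriv (μ : Measure I) (f : ℝ → ℝ) (g : L2 μ) : Prop :=
  ContDiffOn ℝ 1 f (Icc 0 1) ∧
    ∀ x : I, derivWithin f (Icc 0 1) x = derivWithin f (Icc 0 1) 0 + ∫ y in Iic x, g y ∂μ

/-- The boundary condition for functions in the domain of the Krein–Feller operator:
`f'(0) = f'(1) = 0` (Neumann) or `f(0) = f(1) = 0` (Dirichlet). -/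
def BoundaryCondition.Holds : BoundaryCondition → (ℝ → ℝ) → Prop
  | .neumann, f => derivWithin f (Icc 0 1) 0 = 0 ∧ derivWithin f (Icc 0 1) 1 = 0
  | .dirichlet, f => f 0 = 0 ∧ f 1 = 0

/-- The Krein–Feller operator `Δ_μ^b` on `L²([0,1], μ)`, given by its graph: `(u, g)` belongs to it
iff `u` has a `C¹` representative `f` which satisfies the boundary condition `b` and whose
derivative has the `μ`-derivative `g`. -/
def kreinFeller (b : BoundaryCondition) (μ : Measure I) : Set (L2 μ × L2 μ) :=
  {p | ∃ f : ℝ → ℝ, HasSecondMuDeriv μ f p.2 ∧ b.Holds f ∧ p.1 =ᵐ[μ] fun x : I => f x}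

end KreinFeller

section Semigroup

/-- Strongly continuous one-parameter semigroups of bounded operators on a normed space. -/
structure StronglyContinuousSemigroup (X : Type*) [NormedAddCommGroup X] [NormedSpace ℝ X] where
  /-- the operators `T_t`, `t ≥ 0` -/
  op : ℝ≥0 → X →L[ℝ] X
  op_zero : op 0 = ContinuousLinearMap.id ℝ X
  op_add : ∀ s t : ℝ≥0, op (s + t) = (op s).comp (op t)
  continuous_orbit : ∀ x : X, Continuous fun t : ℝ≥0 => op t x

/-- The graph of the infinitesimal generator of a semigroup: all `(x, y)` such that
`(T_h x - x) / h → y` in norm as `h ↓ 0`. -/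
def StronglyContinuousSemigroup.generator {X : Type*} [NormedAddCommGroup X] [NormedSpace ℝ X]
    (T : StronglyContinuousSemigroup X) : Set (X × X) :=
  {p | Tendsto (fun h : ℝ≥0 => (h : ℝ)⁻¹ • (T.op h p.1 - p.1)) (𝓝[>] 0) (𝓝 p.2)}

/-- The restriction `T̄_t : V → V` of the operators of a semigroup to an invariant subspace `V`. -/
def StronglyContinuousSemigroup.restrict {X : Type*} [NormedAddCommGroup X] [NormedSpace ℝ X]
    (T : StronglyContinuousSemigroup X) (V : Submodule ℝ X)
    (hV : ∀ (t : ℝ≥0), ∀ u ∈ V, T.op t u ∈ V) (t : ℝ≥0) (u : V) : V :=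
  ⟨T.op t u, hV t u u.2⟩

end Semigroup

section ContinuousClasses

/-- The space `(C[0,1])_μ^b`: all elements of `L²([0,1], μ)` which possess a continuous
representative, with values `0` at `0` and `1` in the Dirichlet case. -/
def contSpace (b : BoundaryCondition) (μ : Measure I) : Submodule ℝ (L2 μ) where
  carrier := {u | ∃ f : C(I, ℝ), u =ᵐ[μ] f ∧ (b = .dirichlet → f 0 = 0 ∧ f 1 = 0)}
  zero_mem' := ⟨0, Lp.coeFn_zero ℝ 2 μ, by simp⟩
  add_mem' := by
    rintro u v ⟨f, hf, hf0⟩ ⟨g, hg, hg0⟩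
    refine ⟨f + g, ?_, fun hb => ?_⟩
    · filter_upwards [Lp.coeFn_add u v, hf, hg] with x h1 h2 h3
      exact h1.trans (by simp [h2, h3])
    · simp [hf0 hb, hg0 hb]
  smul_mem' := by
    rintro c u ⟨f, hf, hf0⟩
    refine ⟨c • f, ?_, fun hb => ?_⟩
    · filter_upwards [Lp.coeFn_smul c u, hf] with x h1 h2
      exact h1.trans (by simp [h2])
    · simp [hf0 hb]

/-- `f` is linear (i.e. affine) on every interval contained in the complement of `K`
(including the end points of the interval). -/
def LinearOnGaps (K : Set I) (f : I → ℝ) : Prop :=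
  ∀ a b : I, a < b → Disjoint (Ioo a b) K → ∃ c d : ℝ, ∀ x ∈ Icc a b, f x = c + d * x

/-- Linear interpolation of a continuous function across the gaps of a closed set. -/
theorem exists_interpolation_real (K : Set ℝ) (hK : IsClosed K) (h0 : (0 : ℝ) ∈ K)
    (h1 : (1 : ℝ) ∈ K) (f : ℝ → ℝ) (hf : Continuous f) :
    ∃ F : ℝ → ℝ, ContinuousOn F (Icc 0 1) ∧ (∀ x ∈ Icc (0 : ℝ) 1, x ∈ K → F x = f x) ∧
      ∀ a b : ℝ, 0 ≤ a → a < b → b ≤ 1 → Disjoint (Ioo a b) K →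
        ∃ c d : ℝ, ∀ x ∈ Icc a b, F x = c + d * x := by
  have key : ∀ x : ℝ, ∃ l r : ℝ, x ∈ Icc (0 : ℝ) 1 →
      l ∈ K ∧ r ∈ K ∧ 0 ≤ l ∧ l ≤ x ∧ x ≤ r ∧ r ≤ 1 ∧ ∀ y ∈ K, y ≤ l ∨ r ≤ y := by
    intro x
    by_cases hx : x ∈ Icc (0 : ℝ) 1
    · have c1 : IsCompact (K ∩ Icc 0 x) := isCompact_Icc.inter_left hK
      have c2 : IsCompact (K ∩ Icc x 1) := isCompact_Icc.inter_left hK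
      obtain ⟨l, hl, hlm⟩ := c1.exists_isGreatest ⟨0, h0, le_rfl, hx.1⟩
      obtain ⟨r, hr, hrm⟩ := c2.exists_isLeast ⟨1, h1, hx.2, le_rfl⟩
      refine ⟨l, r, fun _ => ⟨hl.1, hr.1, hl.2.1, hl.2.2, hr.2.1, hr.2.2, fun y hy => ?_⟩⟩
      rcases le_total y x with h | h
      · left
        by_cases hy0 : 0 ≤ y
        · exact hlm ⟨hy, hy0, h⟩
        · linarith [hl.2.1]
      · right
        by_cases hy1 : y ≤ 1
        · exact hrm ⟨hy, h, hy1⟩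
        · linarith [hr.2.2]
    · exact ⟨0, 0, fun h => absurd h hx⟩
  choose l r hlr using key
  set F : ℝ → ℝ := fun x => f (l x) + (x - l x) / (r x - l x) * (f (r x) - f (l x)) with hF
  have hFK : ∀ x ∈ Icc (0 : ℝ) 1, x ∈ K → F x = f x := by
    intro x hx hxK
    obtain ⟨_, _, _, hlx, hxr, _, hgap⟩ := hlr x hx
    rcases hgap x hxK with h | h
    · have : l x = x := le_antisymm hlx h
      simp [hF, this]
    · have hr : r x = x := le_antisymm h hxr
      by_cases hl : l x = x
      · simp [hF, hl]
      · have : x - l x ≠ 0 := fun h => hl (by linarith)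
        simp [hF, hr, div_self this]
  -- `F` is affine between neighbouring points of `K`
  have haff : ∀ x ∈ Icc (0 : ℝ) 1, l x < r x → ∀ y ∈ Icc (l x) (r x),
      F y = f (l x) + (y - l x) / (r x - l x) * (f (r x) - f (l x)) := by
    intro x hx hlt y hy
    obtain ⟨hlK, hrK, hl0, hlx, hxr, hr1, hgap⟩ := hlr x hx
    have hyI : y ∈ Icc (0 : ℝ) 1 := ⟨hl0.trans hy.1, hy.2.trans hr1⟩
    rcases eq_or_lt_of_le hy.1 with h | h
    · rw [← h, hFK _ (h ▸ hyI) hlK]; simp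
    rcases eq_or_lt_of_le hy.2 with h' | h'
    · rw [h', hFK _ (h' ▸ hyI) hrK, div_self (by linarith)]; ring
    obtain ⟨hlK', hrK', _, hly, hyr, _, hgap'⟩ := hlr y hyI
    have e1 : l y = l x := by
      apply le_antisymm
      · rcases hgap _ hlK' with h2 | h2
        · exact h2
        · linarith
      · rcases hgap' _ hlK with h2 | h2
        · exact h2
        · linarith
    have e2 : r y = r x := by
      apply le_antisymm
      · rcases hgap' _ hrK with h2 | h2
        · linarith
        · exact h2
      · rcases hgap _ hrK' with h2 | h2
        · linarith
        · exact h2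
    simp only [hF, e1, e2]
  refine ⟨F, ?_, hFK, ?_⟩
  · intro x hx
    by_cases hxK : x ∈ K
    · rw [ContinuousWithinAt, hFK x hx hxK, Metric.tendsto_nhdsWithin_nhds]
      intro ε hε
      obtain ⟨δ, hδ, hfδ⟩ := Metric.continuous_iff.1 hf x (ε / 2) (by linarith)
      obtain ⟨M, hM⟩ := (isCompact_Icc (a := (0 : ℝ)) (b := 1)).exists_bound_of_continuousOn
        hf.continuousOn
      have hM0 : 0 ≤ M := (norm_nonneg _).trans (hM x hx)
      have hη : 0 < ε * δ / (4 * (M + 1)) := by positivity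
      refine ⟨min δ (ε * δ / (4 * (M + 1))), lt_min hδ hη, fun {y} hy hyx => ?_⟩
      obtain ⟨hy1, hy2⟩ := lt_min_iff.1 hyx
      rw [Real.dist_eq] at hy1 hy2
      rw [lt_div_iff₀ (by positivity)] at hy2
      rw [Real.dist_eq]
      obtain ⟨hlK, hrK, hl0, hly, hyr, hr1, hgap⟩ := hlr y hy
      rcases eq_or_lt_of_le (hly.trans hyr) with he | hlt
      · have hyl : l y = y := le_antisymm hly (he ▸ hyr)
        have := hfδ y (by rwa [Real.dist_eq])
        rw [Real.dist_eq] at this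
        have e : F y = f y := by simp [hF, hyl]
        rw [e]; linarith
      set s := (y - l y) / (r y - l y) with hs
      have hd : 0 < r y - l y := by linarith
      have hs0 : 0 ≤ s := div_nonneg (by linarith) hd.le
      have hs1 : s ≤ 1 := (div_le_one hd).2 (by linarith)
      have hsd : s * (r y - l y) = y - l y := div_mul_cancel₀ _ hd.ne'
      have hb : |F y - f x| ≤ (1 - s) * |f (l y) - f x| + s * |f (r y) - f x| := by
        have : F y - f x = (1 - s) * (f (l y) - f x) + s * (f (r y) - f x) := by
          simp only [hF]; rw [← hs]; ring
        rw [this]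
        refine (abs_add_le _ _).trans ?_
        rw [abs_mul, abs_mul, abs_of_nonneg hs0, abs_of_nonneg (by linarith : 0 ≤ 1 - s)]
      have hbound : ∀ z ∈ Icc (0 : ℝ) 1, |f z - f x| ≤ 2 * M := by
        intro z hz
        have h1 := hM z hz
        have h2 := hM x hx
        rw [Real.norm_eq_abs] at h1 h2
        exact (abs_sub _ _).trans (by linarith)
      have hnear : ∀ z, |z - x| < δ → |f z - f x| < ε / 2 := by
        intro z hz
        have := hfδ z (by rwa [Real.dist_eq])
        rwa [Real.dist_eq] at this
      have hlI : l y ∈ Icc (0 : ℝ) 1 := ⟨hl0, hly.trans hy.2⟩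
      have hrI : r y ∈ Icc (0 : ℝ) 1 := ⟨hy.1.trans hyr, hr1⟩
      rcases hgap x hxK with hxl | hrx
      · -- `x ≤ l y ≤ y`
        rw [abs_of_nonneg (by linarith)] at hy1 hy2
        have n1 := hnear (l y) (by rw [abs_of_nonneg (by linarith)]; linarith)
        by_cases hr : r y - x < δ
        · have n2 := hnear (r y) (by rw [abs_of_nonneg (by linarith)]; linarith)
          nlinarith
        · push Not at hr
          have n2 := hbound _ hrI
          have hsδ : s * δ ≤ y - x := by nlinarith
          have : s * (4 * (M + 1)) < ε := by
            have : s * (4 * (M + 1)) * δ < ε * δ := by nlinarith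
            exact lt_of_mul_lt_mul_right this hδ.le
          nlinarith [abs_nonneg (f (l y) - f x), abs_nonneg (f (r y) - f x)]
      · -- `y ≤ r y ≤ x`
        rw [abs_sub_comm, abs_of_nonneg (by linarith)] at hy1 hy2
        have n1 := hnear (r y) (by rw [abs_sub_comm, abs_of_nonneg (by linarith)]; linarith)
        by_cases hl : x - l y < δ
        · have n2 := hnear (l y) (by rw [abs_sub_comm, abs_of_nonneg (by linarith)]; linarith)
          nlinarith
        · push Not at hl
          have n2 := hbound _ hlI
          have hsδ : (1 - s) * δ ≤ x - y := by nlinarith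
          have : (1 - s) * (4 * (M + 1)) < ε := by
            have : (1 - s) * (4 * (M + 1)) * δ < ε * δ := by nlinarith
            exact lt_of_mul_lt_mul_right this hδ.le
          nlinarith [abs_nonneg (f (l y) - f x), abs_nonneg (f (r y) - f x)]
    · obtain ⟨hlK, hrK, hl0, hlx, hxr, hr1, hgap⟩ := hlr x hx
      have h1 : l x < x := lt_of_le_of_ne hlx (fun h => hxK (h ▸ hlK))
      have h2 : x < r x := lt_of_le_of_ne hxr (fun h => hxK (h ▸ hrK))
      have : F =ᶠ[𝓝 x] fun y => f (l x) + (y - l x) / (r x - l x) * (f (r x) - f (l x)) := by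
        filter_upwards [Icc_mem_nhds h1 h2] with y hy
        exact haff x hx (h1.trans h2) y hy
      refine ContinuousAt.continuousWithinAt ?_
      rw [continuousAt_congr this]
      fun_prop
  · intro a b ha hab hb hdisj
    have hm : (a + b) / 2 ∈ Icc (0 : ℝ) 1 := ⟨by linarith, by linarith⟩
    obtain ⟨hlK, hrK, hl0, hlx, hxr, hr1, hgap⟩ := hlr _ hm
    have hla : l ((a + b) / 2) ≤ a := by
      by_contra h
      push Not at h
      exact Set.disjoint_left.1 hdisj ⟨h, by linarith⟩ hlK
    have hrb : b ≤ r ((a + b) / 2) := by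
      by_contra h
      push Not at h
      exact Set.disjoint_left.1 hdisj ⟨by linarith, h⟩ hrK
    generalize hL : l ((a + b) / 2) = L at *
    generalize hR : r ((a + b) / 2) = R at *
    refine ⟨f L - L / (R - L) * (f R - f L), (f R - f L) / (R - L), fun x hx => ?_⟩
    have := haff _ hm (by rw [hL, hR]; linarith) x (by
      rw [hL, hR]; exact ⟨hla.trans hx.1, hx.2.trans hrb⟩)
    rw [this, hL, hR]
    ring

/-- Every element of `(C[0,1])_μ^b` has a continuous representative that satisfies the boundary
condition and is linear on all intervals in `[0,1] \ supp μ`. -/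
theorem exists_linRep (b : BoundaryCondition) (μ : Measure I) [MassDistribution μ]
    (u : contSpace b μ) :
    ∃ f : C(I, ℝ), (u : L2 μ) =ᵐ[μ] f ∧ LinearOnGaps μ.support f ∧
      (b = .dirichlet → f 0 = 0 ∧ f 1 = 0) := by
  obtain ⟨f, huf, hbc⟩ := u.2
  have hcl : IsClosed ((↑) '' μ.support : Set ℝ) :=
    (isClosed_Icc.isClosedEmbedding_subtypeVal).isClosedMap _ Measure.isClosed_support
  obtain ⟨F, hFc, hFK, hFl⟩ := exists_interpolation_real ((↑) '' μ.support) hcl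
    ⟨0, MassDistribution.zero_mem_support, rfl⟩ ⟨1, MassDistribution.one_mem_support, rfl⟩
    (IccExtend zero_le_one f) f.continuous.Icc_extend'
  have hagree : ∀ x : I, x ∈ μ.support → F x = f x := by
    intro x hx
    rw [hFK x x.2 ⟨x, hx, rfl⟩, IccExtend_val]
  refine ⟨⟨fun x => F x, hFc.domRestrict⟩, ?_, ?_, fun hb => ?_⟩
  · filter_upwards [huf, Measure.support_mem_ae (μ := μ)] with x h1 h2
    rw [h1]
    exact (hagree x h2).symm
  · intro a c hac hdisj
    obtain ⟨p, q, hpq⟩ := hFl a c a.2.1 hac c.2.2 (by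
      rw [Set.disjoint_left]
      rintro _ hx ⟨y, hy, rfl⟩
      have hy' : y ∈ Ioo a c := ⟨hx.1, hx.2⟩
      exact (Set.disjoint_left.1 hdisj) hy' hy)
    exact ⟨p, q, fun x hx => hpq x ⟨hx.1, hx.2⟩⟩
  · exact ⟨(hagree 0 MassDistribution.zero_mem_support).trans (hbc hb).1,
      (hagree 1 MassDistribution.one_mem_support).trans (hbc hb).2⟩

/-- The continuous representative `ũ` of `u ∈ (C[0,1])_μ^b` that is linear on all intervals in
`[0,1] \ supp μ`. -/
noncomputable def linRep (b : BoundaryCondition) (μ : Measure I) [MassDistribution μ]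
    (u : contSpace b μ) : C(I, ℝ) :=
  (exists_linRep b μ u).choose

theorem linRep_spec (b : BoundaryCondition) (μ : Measure I) [MassDistribution μ]
    (u : contSpace b μ) :
    (u : L2 μ) =ᵐ[μ] linRep b μ u ∧ LinearOnGaps μ.support (linRep b μ u) ∧
      (b = .dirichlet → linRep b μ u 0 = 0 ∧ linRep b μ u 1 = 0) :=
  (exists_linRep b μ u).choose_spec

/-- The norm `‖u‖_∞` of `(C[0,1])_μ^b`: the supremum over `supp μ` of the absolute value of the
continuous representative. -/
noncomputable def supNorm (b : BoundaryCondition) (μ : Measure I) [MassDistribution μ]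
    (u : contSpace b μ) : ℝ :=
  ⨆ x : μ.support, |linRep b μ u x|

/-- The map `π : (C[0,1])_μ^b → (C[0,1])_ν^b` which sends `u` to the `ν`-class of the continuous
representative of `u` that is linear on all intervals in `[0,1] \ supp μ`. -/
noncomputable def embed (b : BoundaryCondition) (μ ν : Measure I) [MassDistribution μ]
    [MassDistribution ν] (u : contSpace b μ) : contSpace b ν :=
  ⟨ContinuousMap.toLp 2 ν ℝ (linRep b μ u), linRep b μ u,
    ContinuousMap.coeFn_toLp ν (linRep b μ u), (linRep_spec b μ u).2.2⟩

end ContinuousClasses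

/-! The point is to let all semigroups act on one Banach space, `C(I, ℝ)`. A class in (C[0,1])_ν is
represented by its continuous function that is linear on the gaps of supp ν (`gapSpace`). Since supp
μ ⊆ supp μ_n, a function linear on the gaps of supp μ is linear on those of supp μ_n. In this
picture π_n is the identity, and the claim becomes an instance of the Trotter–Kato theorem.

The equation l f - Δ_ν f = h is used in integrated form (`IsPotential`): f is affine plus ∫ min(x,y)
w(y) dν(y) with w = h - l f. Coercivity on L² solves it (`exists_resolvent`), giving an operator
from L² to C[0,1]. An energy estimate makes it a contraction resolvent on L², and the maximum
principle (`IsPotential.le_of_le`) makes it one on C[0,1]. The latter need not have dense range, but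
the closure of its range contains `gapSpace` (`gapSpace_le_resolventClosure`): potentials of unit
mass concentrated near a support point p approximate min(x,p), and such functions build the
piecewise linear functions with nodes in the support.

Yosida approximation yields the L² semigroup (`exists_semigroup`, `generator_eq`), which is
determined by its generator (`eq_of_generator_eq`). The same approximations converge in sup norm on
`gapSpace`, and their limits represent the L² semigroup (`tendsto_yosida_spec`), so continuous
classes are preserved. Weak convergence of the measures gives sup-norm convergence of the resolvents
(`tendsto_resolventC`), because the kernel min(x,y) is continuous and Lipschitz in x. Trotter–Kato
(`eventually_norm_limit_sub_lt`) then concludes. -/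

section OperatorExponential

/-! ### Exponentials of bounded operators -/

variable {X : Type*} [NormedAddCommGroup X] [NormedSpace ℝ X]

theorem norm_pow_apply_le {B : X →L[ℝ] X} {c : ℝ} (hc : 0 ≤ c) (hB : ∀ x, ‖B x‖ ≤ c * ‖x‖) (n : ℕ)
    (x : X) : ‖(B ^ n) x‖ ≤ c ^ n * ‖x‖ := by
  induction n with
  | zero => simp
  | succ n ih =>
    rw [pow_succ', mul_apply_eq_comp, pow_succ', mul_assoc]
    exact (hB _).trans (mul_le_mul_of_nonneg_left ih hc)

variable [CompleteSpace X]

theorem hasSum_exp_apply (B : X →L[ℝ] X) (x : X) :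
    HasSum (fun n : ℕ => ((n.factorial : ℝ))⁻¹ • (B ^ n) x) (NormedSpace.exp B x) := by
  have h := NormedSpace.exp_series_hasSum_exp' (𝕂 := ℝ) B
  simpa using h.mapL (ContinuousLinearMap.apply ℝ X x)

theorem norm_exp_apply_le {B : X →L[ℝ] X} {c : ℝ} (hc : 0 ≤ c) (hB : ∀ x, ‖B x‖ ≤ c * ‖x‖) (x : X) :
    ‖NormedSpace.exp B x‖ ≤ Real.exp c * ‖x‖ := by
  have h2 : HasSum (fun n : ℕ => ((n.factorial : ℝ))⁻¹ * c ^ n * ‖x‖) (Real.exp c * ‖x‖) := by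
    have := NormedSpace.exp_series_hasSum_exp' (𝕂 := ℝ) c
    rw [← Real.exp_eq_exp_ℝ] at this
    simpa using this.mul_right ‖x‖
  refine (hasSum_exp_apply B x).norm_le_of_bounded h2 fun n => ?_
  rw [norm_smul, Real.norm_of_nonneg (by positivity), mul_assoc]
  exact mul_le_mul_of_nonneg_left (norm_pow_apply_le hc hB n x) (by positivity)

theorem exp_apply_mem {B : X →L[ℝ] X} {V : Submodule ℝ X} (hV : IsClosed (V : Set X))
    (hB : ∀ x ∈ V, B x ∈ V) {x : X} (hx : x ∈ V) : NormedSpace.exp B x ∈ V := by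
  have hpow : ∀ n : ℕ, (B ^ n) x ∈ V := by
    intro n
    induction n with
    | zero => simpa using hx
    | succ n ih => rw [pow_succ', mul_apply_eq_comp]; exact hB _ ih
  exact hV.mem_of_tendsto (hasSum_exp_apply B x)
    (Eventually.of_forall fun s => V.sum_mem fun n _ => V.smul_mem _ (hpow n))

theorem map_exp_apply {Y : Type*} [NormedAddCommGroup Y] [NormedSpace ℝ Y] [CompleteSpace Y]
    {B : X →L[ℝ] X} {C : Y →L[ℝ] Y} (J : X →L[ℝ] Y) (h : ∀ x, J (B x) = C (J x)) (x : X) :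
    J (NormedSpace.exp B x) = NormedSpace.exp C (J x) := by
  have hpow : ∀ n : ℕ, J ((B ^ n) x) = (C ^ n) (J x) := by
    intro n
    induction n with
    | zero => simp
    | succ n ih => rw [pow_succ', pow_succ', mul_apply_eq_comp, h, ih]; rfl
  have h1 := (hasSum_exp_apply B x).mapL J
  simp only [map_smul, hpow] at h1
  exact h1.unique (hasSum_exp_apply C (J x))

theorem hasDerivAt_exp_smul_apply (A : X →L[ℝ] X) (x : X) (t : ℝ) :
    HasDerivAt (fun s : ℝ => NormedSpace.exp (s • A) x) (NormedSpace.exp (t • A) (A x)) t := by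
  have h := hasDerivAt_exp_smul_const (𝕂 := ℝ) A t
  simpa [Function.comp_def] using
    (ContinuousLinearMap.apply ℝ X x).hasFDerivAt.comp_hasDerivAt t h

/-- Comparison of two commuting contraction groups with bounded generators. -/
theorem norm_exp_smul_sub_exp_smul_le {A B : X →L[ℝ] X} (hAB : Commute A B)
    (hA : ∀ s : ℝ, 0 ≤ s → ∀ x, ‖NormedSpace.exp (s • A) x‖ ≤ ‖x‖)
    (hB : ∀ s : ℝ, 0 ≤ s → ∀ x, ‖NormedSpace.exp (s • B) x‖ ≤ ‖x‖) {t : ℝ} (ht : 0 ≤ t) (x : X) :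
    ‖NormedSpace.exp (t • A) x - NormedSpace.exp (t • B) x‖ ≤ t * ‖A x - B x‖ := by
  -- The path e^{sA} e^{(t-s)B} x leads from e^{tB} x to e^{tA} x; by commutation its derivative is
  -- e^{sA} e^{(t-s)B} (A x - B x), of norm at most ‖A x - B x‖.
  have hd : ∀ s ∈ Icc 0 t, HasDerivWithinAt
      (fun s : ℝ => (NormedSpace.exp (s • A) * NormedSpace.exp ((t - s) • B)) x)
      (NormedSpace.exp (s • A) (NormedSpace.exp ((t - s) • B) (A x - B x))) (Icc 0 t) s := by
    intro s _
    have h1 := hasDerivAt_exp_smul_const (𝕂 := ℝ) A s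
    have h2 := (hasDerivAt_exp_smul_const' (𝕂 := ℝ) B (t - s)).scomp s
      ((hasDerivAt_id s).const_sub t)
    have h3 := (ContinuousLinearMap.apply ℝ X x).hasFDerivAt.comp_hasDerivAt s (h1.mul h2)
    refine HasDerivAt.hasDerivWithinAt (h3.congr_deriv ?_)
    have c1 : Commute A (NormedSpace.exp ((t - s) • B)) := (hAB.smul_right (t - s)).exp_right
    have c2 : Commute B (NormedSpace.exp ((t - s) • B)) :=
      ((Commute.refl B).smul_right (t - s)).exp_right
    have e1 := congrArg (fun C : X →L[ℝ] X => NormedSpace.exp (s • A) (C x)) c1.eq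
    have e2 := congrArg (fun C : X →L[ℝ] X => NormedSpace.exp (s • A) (C x)) c2.eq
    simp only [mul_apply_eq_comp] at e1 e2
    simp [e1, e2]
    abel
  have := norm_image_sub_le_of_norm_deriv_le_segment' hd (C := ‖A x - B x‖) (fun s hs =>
    (hA s hs.1 _).trans (hB (t - s) (by linarith [hs.2]) _)) t (right_mem_Icc.2 ht)
  simpa [mul_comm] using this

end OperatorExponential

/-! ### Contraction resolvents and their Yosida approximations -/

/-- A resolvent family of contraction type on a Banach space (possibly without dense range). -/
structure ContractionResolvent (X : Type*) [NormedAddCommGroup X] [NormedSpace ℝ X] where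
  /-- the operators `R_λ`, `λ > 0` -/
  R : ℝ → X →L[ℝ] X
  sub_eq : ∀ l m : ℝ, 0 < l → 0 < m → ∀ x, R l x - R m x = (m - l) • R l (R m x)
  norm_le : ∀ l : ℝ, 0 < l → ∀ x, l * ‖R l x‖ ≤ ‖x‖

namespace ContractionResolvent

variable {X : Type*} [NormedAddCommGroup X] [NormedSpace ℝ X] (𝓡 : ContractionResolvent X)

/-- The Yosida approximation of the generator. -/
noncomputable def gen (l : ℝ) : X →L[ℝ] X := l ^ 2 • 𝓡.R l - l • ContinuousLinearMap.id ℝ X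

/-- The semigroup generated by the Yosida approximation. -/
noncomputable def yosida (l t : ℝ) : X →L[ℝ] X := NormedSpace.exp (t • 𝓡.gen l)

theorem gen_apply (l : ℝ) (x : X) : 𝓡.gen l x = l ^ 2 • 𝓡.R l x - l • x := rfl

theorem R_comm {l m : ℝ} (hl : 0 < l) (hm : 0 < m) (x : X) :
    𝓡.R l (𝓡.R m x) = 𝓡.R m (𝓡.R l x) := by
  rcases eq_or_ne l m with rfl | h
  · rfl
  have h1 := 𝓡.sub_eq l m hl hm x
  have h2 := 𝓡.sub_eq m l hm hl x
  have h3 : (m - l) • 𝓡.R l (𝓡.R m x) = (m - l) • 𝓡.R m (𝓡.R l x) := by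
    rw [← h1, ← neg_sub l m, neg_smul, ← h2, neg_sub]
  exact smul_right_injective X (sub_ne_zero.2 h.symm) h3

theorem gen_commute {l m : ℝ} (hl : 0 < l) (hm : 0 < m) : Commute (𝓡.gen l) (𝓡.gen m) := by
  have h : Commute (𝓡.R l) (𝓡.R m) := by
    ext x; exact 𝓡.R_comm hl hm x
  have h1 : ∀ (A : X →L[ℝ] X) (c : ℝ), Commute A (c • ContinuousLinearMap.id ℝ X) := fun A c =>
    (Commute.one_right A).smul_right c
  exact (((h.smul_right _).smul_left _).sub_right (h1 _ _)).sub_left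
    ((h1 _ _).symm)

theorem norm_R_le {l : ℝ} (hl : 0 < l) (x : X) : ‖𝓡.R l x‖ ≤ ‖x‖ / l := by
  rw [le_div_iff₀ hl, mul_comm]; exact 𝓡.norm_le l hl x

/-- The action of the Yosida approximation on the range of the resolvent. -/
theorem gen_R {l : ℝ} (hl : 0 < l) (y : X) : 𝓡.gen l (𝓡.R 1 y) = l • 𝓡.R l (𝓡.R 1 y - y) := by
  have h : 𝓡.R l (𝓡.R 1 y - y) = l • 𝓡.R l (𝓡.R 1 y) - 𝓡.R 1 y := by
    have := 𝓡.sub_eq l 1 hl one_pos y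
    rw [map_sub]
    linear_combination (norm := module) (-1 : ℝ) • this
  rw [gen_apply, h]; module

theorem norm_gen_R_le {l : ℝ} (hl : 0 < l) (y : X) : ‖𝓡.gen l (𝓡.R 1 y)‖ ≤ 2 * ‖y‖ := by
  rw [𝓡.gen_R hl, norm_smul, Real.norm_of_nonneg hl.le]
  refine (𝓡.norm_le l hl _).trans ((norm_sub_le _ _).trans ?_)
  have := 𝓡.norm_le 1 one_pos y
  linarith

theorem norm_smul_R_sub_le {l : ℝ} (hl : 0 < l) (y : X) :
    ‖l • 𝓡.R l (𝓡.R 1 y) - 𝓡.R 1 y‖ ≤ 2 * ‖y‖ / l := by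
  have h : l • 𝓡.R l (𝓡.R 1 y) - 𝓡.R 1 y = 𝓡.R l (𝓡.R 1 y - y) := by
    have := 𝓡.sub_eq l 1 hl one_pos y
    rw [map_sub]
    linear_combination (norm := module) this
  rw [h]
  refine (𝓡.norm_R_le hl _).trans ?_
  gcongr
  refine (norm_sub_le _ _).trans ?_
  have := 𝓡.norm_le 1 one_pos y
  linarith

theorem norm_smul_R_sub_le_of_near {l : ℝ} (hl : 0 < l) (x y : X) :
    ‖l • 𝓡.R l x - x‖ ≤ 2 * ‖x - 𝓡.R 1 y‖ + 2 * ‖y‖ / l := by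
  have h1 : ‖l • 𝓡.R l (x - 𝓡.R 1 y)‖ ≤ ‖x - 𝓡.R 1 y‖ := by
    rw [norm_smul, Real.norm_of_nonneg hl.le]; exact 𝓡.norm_le l hl _
  have h2 := 𝓡.norm_smul_R_sub_le hl y
  have e : l • 𝓡.R l x - x = l • 𝓡.R l (x - 𝓡.R 1 y) + (l • 𝓡.R l (𝓡.R 1 y) - 𝓡.R 1 y)
      - (x - 𝓡.R 1 y) := by rw [map_sub]; module
  rw [e]
  refine (norm_sub_le _ _).trans ?_
  have := norm_add_le (l • 𝓡.R l (x - 𝓡.R 1 y)) (l • 𝓡.R l (𝓡.R 1 y) - 𝓡.R 1 y)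
  linarith

/-- `l R_l x → x` on the closure of the range of the resolvent. -/
theorem tendsto_smul_R {x : X} (hx : x ∈ closure (range (𝓡.R 1))) :
    Tendsto (fun l : ℝ => l • 𝓡.R l x) atTop (𝓝 x) := by
  rw [Metric.tendsto_nhds]
  intro ε hε
  obtain ⟨_, ⟨y, rfl⟩, hy⟩ := Metric.mem_closure_iff.1 hx (ε / 4) (by linarith)
  rw [dist_eq_norm] at hy
  filter_upwards [eventually_gt_atTop 0, eventually_gt_atTop (4 * ‖y‖ / ε)] with l hl hly
  rw [dist_eq_norm]
  refine (𝓡.norm_smul_R_sub_le_of_near hl x y).trans_lt ?_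
  have : 2 * ‖y‖ / l < ε / 2 := by
    rw [div_lt_iff₀ hε] at hly
    rw [div_lt_iff₀ hl]; linarith
  linarith

/-- On the range of R_1² the approximate generators converge at rate 1/l: `gen_R` turns them into l
R_l applied to R_1 (R_1 v - v), which lies in the range of R_1, where l R_l tends to the identity at
that rate. -/
theorem norm_gen_sub_gen_le {l m : ℝ} (hl : 0 < l) (hm : 0 < m) (v : X) :
    ‖𝓡.gen l (𝓡.R 1 (𝓡.R 1 v)) - 𝓡.gen m (𝓡.R 1 (𝓡.R 1 v))‖ ≤ 4 * ‖v‖ * (1 / l + 1 / m) := by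
  have hw : ‖𝓡.R 1 v - v‖ ≤ 2 * ‖v‖ := by
    have := 𝓡.norm_le 1 one_pos v
    exact (norm_sub_le _ _).trans (by linarith)
  have h : ∀ k : ℝ, 0 < k → ‖𝓡.gen k (𝓡.R 1 (𝓡.R 1 v)) - 𝓡.R 1 (𝓡.R 1 v - v)‖ ≤
      4 * ‖v‖ * (1 / k) := by
    intro k hk
    rw [𝓡.gen_R hk, ← map_sub]
    refine (𝓡.norm_smul_R_sub_le hk _).trans ?_
    rw [mul_one_div]
    exact div_le_div_of_nonneg_right (by linarith) hk.le
  have h1 := h l hl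
  have h2 := h m hm
  rw [← sub_sub_sub_cancel_right _ _ (𝓡.R 1 (𝓡.R 1 v - v))]
  refine (norm_sub_le _ _).trans ?_
  linarith

/-- The range of `R_1 ^ 2` is dense in the closure of the range of `R_1`. -/
theorem exists_norm_sub_R_R_lt {x : X} (hx : x ∈ closure (range (𝓡.R 1))) {ε : ℝ} (hε : 0 < ε) :
    ∃ v, ‖x - 𝓡.R 1 (𝓡.R 1 v)‖ < ε := by
  obtain ⟨_, ⟨y, rfl⟩, hy⟩ := Metric.mem_closure_iff.1 hx (ε / 2) (by linarith)
  rw [dist_eq_norm] at hy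
  have h := 𝓡.tendsto_smul_R (subset_closure ⟨y, rfl⟩)
  obtain ⟨l, hl, hl0⟩ := ((Metric.tendsto_nhds.1 h (ε / 2) (by linarith)).and
    (eventually_gt_atTop 0)).exists
  -- By the resolvent identity R_1 maps y + (1 - l) R_l y to R_l y, so R_1² of this witness is l R_l
  -- R_1 y, which is close to R_1 y for large l.
  refine ⟨l • (y + (1 - l) • 𝓡.R l y), ?_⟩
  have e : 𝓡.R 1 (𝓡.R 1 (l • (y + (1 - l) • 𝓡.R l y))) = l • 𝓡.R l (𝓡.R 1 y) := by
    have := 𝓡.sub_eq 1 l one_pos hl0 y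
    have h2 : 𝓡.R 1 (y + (1 - l) • 𝓡.R l y) = 𝓡.R l y := by
      rw [map_add, map_smul]
      linear_combination (norm := module) this
    rw [map_smul, map_smul, h2, 𝓡.R_comm one_pos hl0]
  rw [e]
  rw [dist_comm, dist_eq_norm] at hl
  have := norm_sub_le_norm_sub_add_norm_sub x (𝓡.R 1 y) (l • 𝓡.R l (𝓡.R 1 y))
  linarith

theorem yosida_zero (l : ℝ) (x : X) : 𝓡.yosida l 0 x = x := by simp [yosida]

variable [CompleteSpace X]

theorem yosida_add (l s t : ℝ) (x : X) :
    𝓡.yosida l (s + t) x = 𝓡.yosida l s (𝓡.yosida l t x) := by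
  have hc : Commute (s • 𝓡.gen l) (t • 𝓡.gen l) :=
    ((Commute.refl (𝓡.gen l)).smul_left s).smul_right t
  let : NormedAlgebra ℚ (X →L[ℝ] X) := NormedAlgebra.restrictScalars ℚ ℝ (X →L[ℝ] X)
  rw [yosida, add_smul, NormedSpace.exp_add_of_commute hc]
  rfl

/-- Splitting off the scalar part of the generator shows contractivity: t l² R_l has norm at most t
l, and the factor e^{-tl} cancels the resulting e^{tl}. -/
theorem yosida_eq (l t : ℝ) (x : X) :
    𝓡.yosida l t x = Real.exp (-(t * l)) • NormedSpace.exp ((t * l ^ 2) • 𝓡.R l) x := by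
  let : NormedAlgebra ℚ (X →L[ℝ] X) := NormedAlgebra.restrictScalars ℚ ℝ (X →L[ℝ] X)
  have e : t • 𝓡.gen l = algebraMap ℝ (X →L[ℝ] X) (-(t * l)) + (t * l ^ 2) • 𝓡.R l := by
    ext x; simp [gen_apply, Algebra.algebraMap_eq_smul_one]; module
  rw [yosida, e, NormedSpace.exp_add_of_commute (Algebra.commutes _ _),
    ← NormedSpace.algebraMap_exp_comm, Algebra.algebraMap_eq_smul_one, ← Real.exp_eq_exp_ℝ]
  simp

theorem norm_yosida_le {l t : ℝ} (hl : 0 < l) (ht : 0 ≤ t) (x : X) : ‖𝓡.yosida l t x‖ ≤ ‖x‖ := by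
  rw [yosida_eq, norm_smul, Real.norm_of_nonneg (Real.exp_pos _).le]
  have h := norm_exp_apply_le (B := (t * l ^ 2) • 𝓡.R l) (c := t * l) (by positivity) (fun y => by
    rw [smul_apply, norm_smul, Real.norm_of_nonneg (by positivity)]
    have := mul_le_mul_of_nonneg_left (𝓡.norm_le l hl y) (by positivity : 0 ≤ t * l)
    linarith) x
  calc _ ≤ Real.exp (-(t * l)) * (Real.exp (t * l) * ‖x‖) := by gcongr
    _ = ‖x‖ := by rw [← mul_assoc, ← Real.exp_add]; simp

theorem norm_yosida_sub_le {l t : ℝ} (hl : 0 < l) (ht : 0 ≤ t) (x y : X) :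
    ‖𝓡.yosida l t x - 𝓡.yosida l t y‖ ≤ ‖x - y‖ := by
  rw [← map_sub]; exact 𝓡.norm_yosida_le hl ht _

theorem norm_yosida_sub_yosida_le {l m t : ℝ} (hl : 0 < l) (hm : 0 < m) (ht : 0 ≤ t) (x : X) :
    ‖𝓡.yosida l t x - 𝓡.yosida m t x‖ ≤ t * ‖𝓡.gen l x - 𝓡.gen m x‖ :=
  norm_exp_smul_sub_exp_smul_le (𝓡.gen_commute hl hm) (fun _ hs => 𝓡.norm_yosida_le hl hs)
    (fun _ hs => 𝓡.norm_yosida_le hm hs) ht x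

theorem norm_yosida_sub_self_le {l t : ℝ} (hl : 0 < l) (ht : 0 ≤ t) (x : X) :
    ‖𝓡.yosida l t x - x‖ ≤ t * ‖𝓡.gen l x‖ := by
  simpa [yosida] using norm_exp_smul_sub_exp_smul_le (Commute.zero_right (𝓡.gen l))
    (fun _ hs => 𝓡.norm_yosida_le hl hs) (fun s hs x => by simp) ht x

theorem norm_yosida_sub_yosida_R_R_le {l m t : ℝ} (hl : 0 < l) (hm : 0 < m) (ht : 0 ≤ t) (v : X) :
    ‖𝓡.yosida l t (𝓡.R 1 (𝓡.R 1 v)) - 𝓡.yosida m t (𝓡.R 1 (𝓡.R 1 v))‖ ≤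
      t * (4 * ‖v‖ * (1 / l + 1 / m)) :=
  (𝓡.norm_yosida_sub_yosida_le hl hm ht _).trans
    (mul_le_mul_of_nonneg_left (𝓡.norm_gen_sub_gen_le hl hm v) ht)

/-- First order expansion of the approximating semigroups. -/
theorem norm_yosida_sub_sub_le {l h : ℝ} (hl : 0 < l) (hh : 0 ≤ h) (x z w : X) :
    ‖𝓡.yosida l h x - x - h • z‖ ≤
      h * (2 * h * ‖w‖ + 2 * ‖z - 𝓡.R 1 w‖ + 2 * ‖𝓡.gen l x - z‖) := by
  have hd : ∀ s ∈ Icc 0 h, HasDerivWithinAt (fun s : ℝ => 𝓡.yosida l s x - s • z)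
      (𝓡.yosida l s (𝓡.gen l x) - z) (Icc 0 h) s := fun s _ => by
    have h2 := (hasDerivAt_exp_smul_apply (𝓡.gen l) x s).sub ((hasDerivAt_id s).smul_const z)
    simp only [one_smul] at h2
    exact h2.hasDerivWithinAt
  have := norm_image_sub_le_of_norm_deriv_le_segment' hd
    (C := 2 * h * ‖w‖ + 2 * ‖z - 𝓡.R 1 w‖ + 2 * ‖𝓡.gen l x - z‖) (fun s hs => ?_) h
    (right_mem_Icc.2 hh)
  · have e : 𝓡.yosida l h x - x - h • z = 𝓡.yosida l h x - h • z -
        (𝓡.yosida l 0 x - (0 : ℝ) • z) := by rw [yosida_zero]; module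
    rw [e, mul_comm]; simpa using this
  -- The orbit of a general z has no speed bound uniform in l, whereas that of R_1 w has speed at
  -- most 2‖w‖; hence the detour through R_1 w.
  · have e : 𝓡.yosida l s (𝓡.gen l x) - z = (𝓡.yosida l s (𝓡.gen l x) - 𝓡.yosida l s z) +
        (𝓡.yosida l s z - 𝓡.yosida l s (𝓡.R 1 w)) +
        (𝓡.yosida l s (𝓡.R 1 w) - 𝓡.R 1 w) - (z - 𝓡.R 1 w) := by abel
    have h1 := 𝓡.norm_yosida_sub_le hl hs.1 (𝓡.gen l x) z
    have h2 := 𝓡.norm_yosida_sub_le hl hs.1 z (𝓡.R 1 w)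
    have h3 := (𝓡.norm_yosida_sub_self_le hl hs.1 (𝓡.R 1 w)).trans
      (mul_le_mul hs.2.le (𝓡.norm_gen_R_le hl w) (norm_nonneg _) hh)
    rw [e]
    refine (norm_sub_le _ _).trans ((add_le_add_left ((norm_add_le _ _).trans
      (add_le_add_left (norm_add_le _ _) _)) _).trans ?_)
    linarith [norm_nonneg (𝓡.gen l x - z)]

theorem exists_tendsto_yosida {x : X} (hx : x ∈ closure (range (𝓡.R 1))) {t : ℝ} (ht : 0 ≤ t) :
    ∃ y, Tendsto (fun l : ℝ => 𝓡.yosida l t x) atTop (𝓝 y) := by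
  refine cauchy_map_iff_exists_tendsto.1 ?_
  rw [Metric.cauchy_iff]
  refine ⟨inferInstance, fun ε hε => ?_⟩
  obtain ⟨v, hv⟩ := 𝓡.exists_norm_sub_R_R_lt hx (show 0 < ε / 4 by linarith)
  -- Beyond M each of the two 1/l terms is below ε/4; replacing x by R_1² v twice costs the other
  -- two quarters.
  set M : ℝ := t * (4 * ‖v‖) * (4 / ε) + 1 with hM
  have hM0 : 0 < M := by positivity
  refine ⟨(fun l : ℝ => 𝓡.yosida l t x) '' Ioi M, image_mem_map (Ioi_mem_atTop M), ?_⟩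
  have key : ∀ l : ℝ, M < l → t * (4 * ‖v‖) * (1 / l) < ε / 4 := by
    intro l hl
    rw [mul_one_div, div_lt_iff₀ (hM0.trans hl)]
    have : t * (4 * ‖v‖) * (4 / ε) < l := by linarith
    have := mul_lt_mul_of_pos_left this (show 0 < ε / 4 by linarith)
    have e : ε / 4 * (t * (4 * ‖v‖) * (4 / ε)) = t * (4 * ‖v‖) := by field_simp
    linarith
  rintro _ ⟨l, hl, rfl⟩ _ ⟨m, hm, rfl⟩
  rw [mem_Ioi] at hl hm
  have hl0 := hM0.trans hl
  have hm0 := hM0.trans hm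
  have h1 := 𝓡.norm_yosida_sub_le hl0 ht x (𝓡.R 1 (𝓡.R 1 v))
  have h2 := 𝓡.norm_yosida_sub_le hm0 ht (𝓡.R 1 (𝓡.R 1 v)) x
  rw [norm_sub_rev (𝓡.R 1 (𝓡.R 1 v)) x] at h2
  have h3 := 𝓡.norm_yosida_sub_yosida_R_R_le hl0 hm0 ht v
  have := key l hl
  have := key m hm
  rw [dist_eq_norm]
  have e : 𝓡.yosida l t x - 𝓡.yosida m t x =
      (𝓡.yosida l t x - 𝓡.yosida l t (𝓡.R 1 (𝓡.R 1 v))) +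
      (𝓡.yosida l t (𝓡.R 1 (𝓡.R 1 v)) - 𝓡.yosida m t (𝓡.R 1 (𝓡.R 1 v))) +
      (𝓡.yosida m t (𝓡.R 1 (𝓡.R 1 v)) - 𝓡.yosida m t x) := by abel
  rw [e]
  refine ((norm_add_le _ _).trans (add_le_add_left (norm_add_le _ _) _)).trans_lt ?_
  linarith

end ContractionResolvent

/-! ### The Trotter–Kato theorem -/

namespace ContractionResolvent

variable {X : Type*} [NormedAddCommGroup X] [NormedSpace ℝ X] (𝓡 : ContractionResolvent X)

theorem norm_gen_le {l : ℝ} (hl : 0 < l) (x : X) : ‖𝓡.gen l x‖ ≤ 2 * l * ‖x‖ := by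
  rw [gen_apply]
  refine (norm_sub_le _ _).trans ?_
  rw [norm_smul, norm_smul, Real.norm_of_nonneg hl.le, Real.norm_of_nonneg (by positivity)]
  have := mul_le_mul_of_nonneg_left (𝓡.norm_le l hl x) hl.le
  linarith

theorem tendsto_gen_pow {𝓡s : ℕ → ContractionResolvent X} {l : ℝ} (hl : 0 < l)
    (h : ∀ x, Tendsto (fun n => (𝓡s n).R l x) atTop (𝓝 (𝓡.R l x))) (k : ℕ) (x : X) :
    Tendsto (fun n => ((𝓡s n).gen l ^ k) x) atTop (𝓝 ((𝓡.gen l ^ k) x)) := by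
  induction k with
  | zero => simp
  | succ k ih =>
    simp only [pow_succ', mul_apply_eq_comp]
    have h1 : Tendsto (fun n => (𝓡s n).gen l ((𝓡.gen l ^ k) x)) atTop
        (𝓝 (𝓡.gen l ((𝓡.gen l ^ k) x))) :=
      ((h _).const_smul _).sub tendsto_const_nhds
    have h2 : Tendsto (fun n => (𝓡s n).gen l (((𝓡s n).gen l ^ k) x - (𝓡.gen l ^ k) x)) atTop
        (𝓝 0) := by
      refine squeeze_zero_norm (fun n => (𝓡s n).norm_gen_le hl _) ?_
      simpa using ((ih.sub_const ((𝓡.gen l ^ k) x)).norm.const_mul (2 * l))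
    have := h1.add h2
    simpa using this

variable [CompleteSpace X]

/-- An error bound that sees the resolvent family only through ‖x - R_1² v‖. This makes the Yosida
approximation uniform over a sequence of families. -/
theorem norm_yosida_sub_limit_le {l t : ℝ} (hl : 0 < l) (ht : 0 ≤ t) {x y : X}
    (hy : Tendsto (fun m : ℝ => 𝓡.yosida m t x) atTop (𝓝 y)) (v : X) :
    ‖𝓡.yosida l t x - y‖ ≤ 2 * ‖x - 𝓡.R 1 (𝓡.R 1 v)‖ + t * (4 * ‖v‖) * (1 / l) := by
  have h1 : Tendsto (fun m : ℝ => 2 * ‖x - 𝓡.R 1 (𝓡.R 1 v)‖ + t * (4 * ‖v‖ * (1 / l + 1 / m)))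
      atTop (𝓝 (2 * ‖x - 𝓡.R 1 (𝓡.R 1 v)‖ + t * (4 * ‖v‖ * (1 / l + 0)))) := by
    have : Tendsto (fun m : ℝ => 1 / m) atTop (𝓝 0) := by
      simpa using tendsto_inv_atTop_zero (𝕜 := ℝ)
    exact ((((this.const_add _).const_mul _).const_mul _).const_add _)
  rw [add_zero, ← mul_assoc] at h1
  refine le_of_tendsto_of_tendsto ((hy.const_sub (𝓡.yosida l t x)).norm) h1 ?_
  filter_upwards [eventually_gt_atTop 0] with m hm
  have h1 := 𝓡.norm_yosida_sub_le hl ht x (𝓡.R 1 (𝓡.R 1 v))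
  have h2 := 𝓡.norm_yosida_sub_le hm ht (𝓡.R 1 (𝓡.R 1 v)) x
  rw [norm_sub_rev (𝓡.R 1 (𝓡.R 1 v)) x] at h2
  have h3 := 𝓡.norm_yosida_sub_yosida_R_R_le hl hm ht v
  have e : 𝓡.yosida l t x - 𝓡.yosida m t x =
      (𝓡.yosida l t x - 𝓡.yosida l t (𝓡.R 1 (𝓡.R 1 v))) +
      (𝓡.yosida l t (𝓡.R 1 (𝓡.R 1 v)) - 𝓡.yosida m t (𝓡.R 1 (𝓡.R 1 v))) +
      (𝓡.yosida m t (𝓡.R 1 (𝓡.R 1 v)) - 𝓡.yosida m t x) := by abel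
  rw [e]
  refine ((norm_add_le _ _).trans (add_le_add_left (norm_add_le _ _) _)).trans ?_
  linarith

/-- Strong resolvent convergence implies convergence of the approximating semigroups, uniformly on
bounded time intervals. -/
theorem eventually_norm_yosida_sub_lt {𝓡s : ℕ → ContractionResolvent X} {l : ℝ} (hl : 0 < l)
    (h : ∀ x, Tendsto (fun n => (𝓡s n).R l x) atTop (𝓝 (𝓡.R l x))) (x : X) (S : ℝ) {ε : ℝ}
    (hε : 0 < ε) :
    ∀ᶠ n in atTop, ∀ t ∈ Icc 0 S, ‖𝓡.yosida l t x - (𝓡s n).yosida l t x‖ < ε := by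
  rcases lt_or_ge S 0 with hS | hS
  · exact Eventually.of_forall fun n t ht => absurd (ht.1.trans ht.2) (not_le.2 hS)
  -- Termwise differences of the two exponential series, at the worst time t = S. Each tends to 0
  -- with n, and the bound ‖gen‖ ≤ 2l provides a summable majorant independent of n.
  set a : ℕ → ℕ → ℝ := fun n k =>
    ((k.factorial : ℝ))⁻¹ * S ^ k * ‖(𝓡.gen l ^ k) x - ((𝓡s n).gen l ^ k) x‖ with ha
  have hpow : ∀ (𝓢 : ContractionResolvent X) (k : ℕ), ‖(𝓢.gen l ^ k) x‖ ≤ (2 * l) ^ k * ‖x‖ :=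
    fun 𝓢 k => norm_pow_apply_le (by positivity) (𝓢.norm_gen_le hl) k x
  have hbsum : Summable fun k : ℕ => ((k.factorial : ℝ))⁻¹ * (S * (2 * l)) ^ k * (2 * ‖x‖) := by
    refine Summable.mul_right _ ?_
    simpa [div_eq_inv_mul] using Real.summable_pow_div_factorial (S * (2 * l))
  have hab : ∀ n k, a n k ≤ ((k.factorial : ℝ))⁻¹ * (S * (2 * l)) ^ k * (2 * ‖x‖) := by
    intro n k
    simp only [ha, mul_pow S, mul_assoc]
    refine mul_le_mul_of_nonneg_left (mul_le_mul_of_nonneg_left ?_ (by positivity)) (by positivity)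
    have := (norm_sub_le ((𝓡.gen l ^ k) x) (((𝓡s n).gen l ^ k) x)).trans
      (add_le_add (hpow 𝓡 k) (hpow (𝓡s n) k))
    linarith
  have ha0 : ∀ n k, 0 ≤ a n k := fun n k => by positivity
  have hsum : ∀ n, Summable (a n) := fun n => Summable.of_nonneg_of_le (ha0 n) (hab n) hbsum
  have hlim : Tendsto (fun n => ∑' k, a n k) atTop (𝓝 (∑' _ : ℕ, (0 : ℝ))) := by
    refine tendsto_tsum_of_dominated_convergence hbsum (fun k => ?_)
      (Eventually.of_forall fun n k => ?_)
    · have := ((𝓡.tendsto_gen_pow hl h k x).const_sub ((𝓡.gen l ^ k) x)).norm.const_mul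
        (((k.factorial : ℝ))⁻¹ * S ^ k)
      simpa [ha] using this
    · rw [Real.norm_of_nonneg (ha0 n k)]; exact hab n k
  rw [tsum_zero] at hlim
  filter_upwards [hlim.eventually_lt_const hε] with n hn t ht
  refine lt_of_le_of_lt ?_ hn
  have h1 := (hasSum_exp_apply (t • 𝓡.gen l) x).sub (hasSum_exp_apply (t • (𝓡s n).gen l) x)
  refine h1.norm_le_of_bounded (hsum n).hasSum fun k => ?_
  rw [← smul_sub, smul_pow, smul_pow, smul_apply, smul_apply, ← smul_sub, norm_smul, norm_smul,
    Real.norm_of_nonneg (by positivity), Real.norm_of_nonneg (pow_nonneg ht.1 k), ← mul_assoc]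
  simp only [ha]
  have := ht.1
  gcongr
  exact ht.2

/-- The Trotter–Kato theorem: strong convergence of resolvents implies convergence of the semigroups
on the closure of the domain, uniformly on bounded time intervals. -/
theorem eventually_norm_limit_sub_lt {𝓡s : ℕ → ContractionResolvent X}
    (h : ∀ l : ℝ, 0 < l → ∀ x, Tendsto (fun n => (𝓡s n).R l x) atTop (𝓝 (𝓡.R l x)))
    {x : X} (hx : x ∈ closure (range (𝓡.R 1))) (S : ℝ) {y : ℝ → X} {ys : ℕ → ℝ → X}
    (hy : ∀ t, 0 ≤ t → Tendsto (fun m : ℝ => 𝓡.yosida m t x) atTop (𝓝 (y t)))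
    (hys : ∀ n t, 0 ≤ t → Tendsto (fun m : ℝ => (𝓡s n).yosida m t x) atTop (𝓝 (ys n t))) {ε : ℝ}
    (hε : 0 < ε) : ∀ᶠ n in atTop, ∀ t ∈ Icc 0 S, ‖y t - ys n t‖ < ε := by
  rcases lt_or_ge S 0 with hS | hS
  · exact Eventually.of_forall fun n t ht => absurd (ht.1.trans ht.2) (not_le.2 hS)
  obtain ⟨v, hv⟩ := 𝓡.exists_norm_sub_R_R_lt hx (show 0 < ε / 8 by linarith)
  have hlim : Tendsto (fun l : ℝ => S * (4 * ‖v‖) * (1 / l)) atTop (𝓝 0) := by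
    simpa using (tendsto_inv_atTop_zero (𝕜 := ℝ)).const_mul (S * (4 * ‖v‖))
  obtain ⟨l, hl, hl0⟩ := ((hlim.eventually_lt_const (show 0 < ε / 8 by linarith)).and
    (eventually_gt_atTop 0)).exists
  -- The v chosen for the limit family also serves all late members of the sequence, so a single l
  -- works for every such n and every t ≤ S.
  have hR : Tendsto (fun n => ‖x - (𝓡s n).R 1 ((𝓡s n).R 1 v)‖) atTop
      (𝓝 ‖x - 𝓡.R 1 (𝓡.R 1 v)‖) := by
    refine (Tendsto.const_sub x ?_).norm
    have h1 := h 1 one_pos (𝓡.R 1 v)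
    have h2 : Tendsto (fun n => (𝓡s n).R 1 ((𝓡s n).R 1 v - 𝓡.R 1 v)) atTop (𝓝 0) := by
      refine squeeze_zero_norm (fun n => (one_mul ‖_‖).symm.le.trans
        ((𝓡s n).norm_le 1 one_pos _)) ?_
      simpa using ((h 1 one_pos v).sub_const (𝓡.R 1 v)).norm
    simpa using h1.add h2
  filter_upwards [hR.eventually_lt_const hv,
    𝓡.eventually_norm_yosida_sub_lt hl0 (h l hl0) x S (show 0 < ε / 8 by linarith)] with n h1 h2 t ht
  have h3 := 𝓡.norm_yosida_sub_limit_le hl0 ht.1 (hy t ht.1) v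
  have h4 := (𝓡s n).norm_yosida_sub_limit_le hl0 ht.1 (hys n t ht.1) v
  have h5 : t * (4 * ‖v‖) * (1 / l) ≤ S * (4 * ‖v‖) * (1 / l) := by
    have := ht.2
    gcongr
  have h6 := h2 t ht
  rw [norm_sub_rev] at h3
  have e : y t - ys n t = (y t - 𝓡.yosida l t x) + (𝓡.yosida l t x - (𝓡s n).yosida l t x) +
    ((𝓡s n).yosida l t x - ys n t) := by abel
  rw [e]
  refine ((norm_add_le _ _).trans (add_le_add_left (norm_add_le _ _) _)).trans_lt ?_
  linarith

/-! ### The Hille–Yosida semigroup and its generator -/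

section HilleYosida

theorem exists_semigroup_op (hd : DenseRange (𝓡.R 1)) (t : ℝ≥0) : ∃ T : X →L[ℝ] X,
    ∀ x, Tendsto (fun l : ℝ => 𝓡.yosida l t x) atTop (𝓝 (T x)) := by
  choose T hT using fun x => 𝓡.exists_tendsto_yosida (hd x) t.2
  have hnorm : ∀ x, ‖T x‖ ≤ 1 * ‖x‖ := fun x => by
    rw [one_mul]
    refine le_of_tendsto (hT x).norm ?_
    filter_upwards [eventually_gt_atTop 0] with l hl using 𝓡.norm_yosida_le hl t.2 x
  refine ⟨LinearMap.mkContinuous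
    { toFun := T
      map_add' := fun x y => tendsto_nhds_unique (hT (x + y)) (by
        simpa using (hT x).add (hT y))
      map_smul' := fun c x => tendsto_nhds_unique (hT (c • x)) (by
        simpa using (hT x).const_smul c) } 1 hnorm, hT⟩

theorem norm_limit_le {t : ℝ} (ht : 0 ≤ t) {x y : X}
    (h : Tendsto (fun l : ℝ => 𝓡.yosida l t x) atTop (𝓝 y)) : ‖y‖ ≤ ‖x‖ := by
  refine le_of_tendsto h.norm ?_
  filter_upwards [eventually_gt_atTop 0] with l hl using 𝓡.norm_yosida_le hl ht x

/-- Equicontinuity in time passes to the limit l → ∞: the approximating orbits of R_1 w have speed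
at most 2‖w‖ whatever l is. -/
theorem norm_limit_sub_limit_le {s t : ℝ} (hs : 0 ≤ s) (hst : s ≤ t) {x y y' : X}
    (h : Tendsto (fun l : ℝ => 𝓡.yosida l s x) atTop (𝓝 y))
    (h' : Tendsto (fun l : ℝ => 𝓡.yosida l t x) atTop (𝓝 y')) (w : X) :
    ‖y' - y‖ ≤ 2 * (t - s) * ‖w‖ + 2 * ‖x - 𝓡.R 1 w‖ := by
  refine le_of_tendsto (h'.sub h).norm ?_
  filter_upwards [eventually_gt_atTop 0] with l hl
  have e : 𝓡.yosida l t x - 𝓡.yosida l s x = 𝓡.yosida l s (𝓡.yosida l (t - s) x - x) := by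
    rw [map_sub, ← yosida_add, add_sub_cancel]
  rw [e]
  refine (𝓡.norm_yosida_le hl hs _).trans ?_
  have h1 := 𝓡.norm_yosida_sub_self_le hl (sub_nonneg.2 hst) (𝓡.R 1 w)
  have h2 := mul_le_mul_of_nonneg_left (𝓡.norm_gen_R_le hl w) (sub_nonneg.2 hst)
  have h3 := 𝓡.norm_yosida_sub_le hl (sub_nonneg.2 hst) x (𝓡.R 1 w)
  have e : 𝓡.yosida l (t - s) x - x = (𝓡.yosida l (t - s) x - 𝓡.yosida l (t - s) (𝓡.R 1 w)) +
    (𝓡.yosida l (t - s) (𝓡.R 1 w) - 𝓡.R 1 w) - (x - 𝓡.R 1 w) := by abel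
  rw [e]
  refine (norm_sub_le _ _).trans ((add_le_add_left (norm_add_le _ _) _).trans ?_)
  linarith

/-- The Hille–Yosida semigroup of a contraction resolvent with dense range. -/
theorem exists_semigroup (hd : DenseRange (𝓡.R 1)) : ∃ T : StronglyContinuousSemigroup X,
    ∀ (t : ℝ≥0) x, Tendsto (fun l : ℝ => 𝓡.yosida l t x) atTop (𝓝 (T.op t x)) := by
  choose T hT using 𝓡.exists_semigroup_op hd
  refine ⟨⟨T, ?_, ?_, ?_⟩, hT⟩
  · ext x
    refine tendsto_nhds_unique (hT 0 x) ?_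
    simp [yosida_zero]
  · intro s t
    ext x
    refine tendsto_nhds_unique (hT (s + t) x) ?_
    have h2 : Tendsto (fun l : ℝ => 𝓡.yosida l s (𝓡.yosida l t x - T t x)) atTop (𝓝 0) := by
      rw [tendsto_zero_iff_norm_tendsto_zero]
      refine squeeze_zero' (Eventually.of_forall fun _ => norm_nonneg _)
        (g := fun l => ‖𝓡.yosida l t x - T t x‖) ?_ ?_
      · filter_upwards [eventually_gt_atTop 0] with l hl using 𝓡.norm_yosida_le hl s.2 _
      · simpa using ((hT t x).sub_const (T t x)).norm
    have := (hT s (T t x)).add h2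
    simpa [yosida_add] using this
  · intro x
    rw [Metric.continuous_iff]
    intro t ε hε
    obtain ⟨w, hw⟩ := Metric.denseRange_iff.1 hd x (ε / 4) (by linarith)
    rw [dist_eq_norm] at hw
    have key : ∀ s t : ℝ≥0, s ≤ t → ‖T t x - T s x‖ ≤ 2 * dist s t * ‖w‖ + ε / 2 := by
      intro s t hst
      have := 𝓡.norm_limit_sub_limit_le s.2 hst (hT s x) (hT t x) w
      have e : dist s t = (t : ℝ) - s := by
        rw [NNReal.dist_eq, abs_sub_comm, abs_of_nonneg (sub_nonneg.2 (NNReal.coe_le_coe.2 hst))]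
      rw [e]
      change _ ≤ 2 * ((t : ℝ) - s) * ‖w‖ + _ at this
      linarith
    refine ⟨ε / (4 * (‖w‖ + 1)), by positivity, fun s hs => ?_⟩
    have h1 : 2 * dist s t * ‖w‖ < ε / 2 := by
      rw [lt_div_iff₀ (by positivity)] at hs
      nlinarith [norm_nonneg w, dist_nonneg (x := s) (y := t)]
    rw [dist_eq_norm]
    rcases le_total s t with hst | hst
    · rw [norm_sub_rev]
      have := key s t hst
      linarith
    · have := key t s hst
      rw [dist_comm] at this
      linarith

variable {𝓡}

/-- On x = R_1 y the approximate generators converge to z = R_1 y - y, so the first order expansion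
survives l → ∞ with remainder h (2h‖w‖ + 2‖z - R_1 w‖). Density allows R_1 w to approach z. -/
theorem mem_generator_of_tendsto {T : StronglyContinuousSemigroup X} (hd : DenseRange (𝓡.R 1))
    (hT : ∀ (t : ℝ≥0) x, Tendsto (fun l : ℝ => 𝓡.yosida l t x) atTop (𝓝 (T.op t x))) (y : X) :
    (𝓡.R 1 y, 𝓡.R 1 y - y) ∈ T.generator := by
  set x := 𝓡.R 1 y with hx
  set z := x - y with hz
  have hgen : Tendsto (fun l => 𝓡.gen l x) atTop (𝓝 z) := by
    refine (𝓡.tendsto_smul_R (hd z)).congr' ?_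
    filter_upwards [eventually_gt_atTop 0] with l hl using (𝓡.gen_R hl y).symm
  have hexp : ∀ (h : ℝ≥0) (w : X), ‖T.op h x - x - (h : ℝ) • z‖ ≤
      h * (2 * h * ‖w‖ + 2 * ‖z - 𝓡.R 1 w‖ + 2 * 0) := by
    intro h w
    have h1 := (((((hgen.sub_const z).norm).const_mul 2).const_add
      (2 * h * ‖w‖ + 2 * ‖z - 𝓡.R 1 w‖)).const_mul (h : ℝ))
    rw [sub_self, norm_zero] at h1
    refine le_of_tendsto_of_tendsto (((hT h x).sub_const x).sub_const ((h : ℝ) • z)).norm h1 ?_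
    filter_upwards [eventually_gt_atTop 0] with l hl using 𝓡.norm_yosida_sub_sub_le hl h.2 x z w
  change Tendsto _ _ _
  rw [Metric.tendsto_nhds]
  intro ε hε
  obtain ⟨w, hw⟩ := Metric.denseRange_iff.1 hd z (ε / 4) (by linarith)
  rw [dist_eq_norm] at hw
  have hsmall : ∀ᶠ h : ℝ≥0 in 𝓝[>] 0, (h : ℝ) * (4 * (‖w‖ + 1)) < ε := by
    have : Tendsto (fun h : ℝ≥0 => (h : ℝ) * (4 * (‖w‖ + 1))) (𝓝[>] 0) (𝓝 0) := by
      have h0 : Continuous fun h : ℝ≥0 => (h : ℝ) * (4 * (‖w‖ + 1)) := by fun_prop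
      have := h0.tendsto 0
      simp only [NNReal.coe_zero, zero_mul] at this
      exact this.mono_left nhdsWithin_le_nhds
    exact this.eventually_lt_const hε
  filter_upwards [hsmall, self_mem_nhdsWithin] with h hh hpos
  have hpos' : (0 : ℝ) < h := hpos
  have e : (h : ℝ)⁻¹ • (T.op h x - x) - z = (h : ℝ)⁻¹ • (T.op h x - x - (h : ℝ) • z) := by
    rw [smul_sub _ (T.op h x - x), smul_smul, inv_mul_cancel₀ hpos'.ne', one_smul]
  rw [dist_eq_norm]
  rw [e, norm_smul, norm_inv, Real.norm_of_nonneg hpos'.le, inv_mul_lt_iff₀ hpos']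
  refine (hexp h w).trans_lt (mul_lt_mul_of_pos_left ?_ hpos')
  nlinarith [norm_nonneg w]

/-- The generator of the Hille–Yosida semigroup is the operator `1 - R_1⁻¹`. -/
theorem generator_eq {T : StronglyContinuousSemigroup X} (hd : DenseRange (𝓡.R 1))
    (hT : ∀ (t : ℝ≥0) x, Tendsto (fun l : ℝ => 𝓡.yosida l t x) atTop (𝓝 (T.op t x))) :
    T.generator = range fun y => (𝓡.R 1 y, 𝓡.R 1 y - y) := by
  refine Subset.antisymm ?_ (range_subset_iff.2 (mem_generator_of_tendsto hd hT))
  rintro ⟨x, z⟩ hxz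
  have h1 := mem_generator_of_tendsto hd hT (x - z)
  set x' := 𝓡.R 1 (x - z)
  change Tendsto _ _ _ at hxz h1
  -- the difference `d` is an eigenvector of the generator with eigenvalue `1`
  have h2 : Tendsto (fun h : ℝ≥0 => (h : ℝ)⁻¹ • (T.op h (x - x') - (x - x'))) (𝓝[>] 0)
      (𝓝 (x - x')) := by
    have := hxz.sub h1
    simp only at this
    convert this using 2
    · rw [← smul_sub, map_sub]; congr 1; abel
    · abel
  set d := x - x'
  -- Dissipativity: contractivity gives (1 + h)‖d‖ - ‖d‖ ≤ ‖T_h d - (1 + h) d‖. The right side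
  -- divided by h tends to 0, which forces d = 0.
  have h3 : ∀ᶠ h : ℝ≥0 in 𝓝[>] 0, ‖d‖ ≤ ‖(h : ℝ)⁻¹ • (T.op h d - d) - d‖ := by
    filter_upwards [self_mem_nhdsWithin] with h hpos
    have hpos' : (0 : ℝ) < h := hpos
    have hc := 𝓡.norm_limit_le h.2 (hT h d)
    have e : (h : ℝ) • ((h : ℝ)⁻¹ • (T.op h d - d) - d) = T.op h d - ((1 : ℝ) + h) • d := by
      rw [smul_sub, smul_smul, mul_inv_cancel₀ hpos'.ne']; module
    have h4 := norm_sub_norm_le (((1 : ℝ) + h) • d) (T.op h d)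
    rw [norm_sub_rev, ← e, norm_smul, norm_smul, Real.norm_of_nonneg hpos'.le,
      Real.norm_of_nonneg (by positivity)] at h4
    have h5 : (h : ℝ) * ‖d‖ ≤ h * ‖(h : ℝ)⁻¹ • (T.op h d - d) - d‖ := by linarith
    exact le_of_mul_le_mul_left h5 hpos'
  have : NeBot (𝓝[>] (0 : ℝ≥0)) := inferInstance
  have h4 : ‖d‖ ≤ 0 := by
    refine ge_of_tendsto ?_ h3
    simpa using (h2.sub_const d).norm
  have hd0 : x' = x := (sub_eq_zero.1 (norm_le_zero_iff.1 h4)).symm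
  refine ⟨x - z, ?_⟩
  change (x', x' - (x - z)) = _
  rw [hd0]; simp

end HilleYosida

end ContractionResolvent

/-! ### A semigroup is determined by its generator -/

namespace StronglyContinuousSemigroup

variable {X : Type*} [NormedAddCommGroup X] [NormedSpace ℝ X]

theorem op_mem_generator (T : StronglyContinuousSemigroup X) {x y : X}
    (h : (x, y) ∈ T.generator) (t : ℝ≥0) : (T.op t x, T.op t y) ∈ T.generator := by
  change Tendsto _ _ _ at h ⊢
  have h1 := ((T.op t).continuous.tendsto y).comp h
  refine h1.congr fun s => ?_
  have e : T.op t (T.op s x) = T.op s (T.op t x) := by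
    rw [← ContinuousLinearMap.comp_apply, ← ContinuousLinearMap.comp_apply, ← T.op_add,
      ← T.op_add, add_comm]
  simp [e]

variable [CompleteSpace X]

theorem exists_norm_op_le (T : StronglyContinuousSemigroup X) (t : ℝ≥0) :
    ∃ C, 0 ≤ C ∧ ∀ s ≤ t, ∀ x, ‖T.op s x‖ ≤ C * ‖x‖ := by
  obtain ⟨C, hC⟩ := banach_steinhaus (g := fun s : Iic t => T.op s) (fun x => by
    have hc : IsCompact (Iic t) := by rw [← Set.Icc_bot]; exact isCompact_Icc
    obtain ⟨C, hC⟩ := hc.exists_bound_of_continuousOn (T.continuous_orbit x).continuousOn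
    exact ⟨C, fun s => hC s s.2⟩)
  refine ⟨max C 0, le_max_right _ _, fun s hs x => ?_⟩
  exact (T.op s).le_of_opNorm_le ((hC ⟨s, hs⟩).trans (le_max_left _ _)) x

/-- A strongly continuous semigroup with dense generator domain is determined by its generator. -/
theorem eq_of_generator_eq {T S : StronglyContinuousSemigroup X} (h : T.generator = S.generator)
    (hd : Dense {x | ∃ y, (x, y) ∈ S.generator}) : T = S := by
  suffices H : ∀ t, T.op t = S.op t by
    cases T; cases S; congr; exact funext H
  intro t
  refine ContinuousLinearMap.ext fun z => ?_
  refine congrFun (Continuous.ext_on hd (T.op t).continuous (S.op t).continuous ?_) z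
  rintro x ⟨y, hxy⟩
  obtain ⟨C, hC0, hC⟩ := T.exists_norm_op_le t
  -- The path T(t-s) S(s) x joins T(t) x to S(t) x. Its right difference quotient is T(t-r) applied
  -- to (S_h - T_h) S(s) x / h with h = r - s, which tends to 0 because the generators agree; so the
  -- path is constant.
  set f : ℝ → X := fun s => T.op (t - s.toNNReal) (S.op s.toNNReal x) with hf
  have hle : ∀ s : ℝ, t - s.toNNReal ≤ t := fun s => tsub_le_self
  have hcont : Continuous f := by
    rw [continuous_iff_continuousAt]
    intro s
    have h1 : Tendsto (fun r : ℝ => T.op (t - r.toNNReal) (S.op s.toNNReal x)) (𝓝 s)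
        (𝓝 (f s)) := by
      have : Continuous fun r : ℝ => T.op (t - r.toNNReal) (S.op s.toNNReal x) :=
        (T.continuous_orbit _).comp (by fun_prop)
      exact this.tendsto s
    have h2 : Tendsto (fun r : ℝ => T.op (t - r.toNNReal) (S.op r.toNNReal x - S.op s.toNNReal x))
        (𝓝 s) (𝓝 0) := by
      refine squeeze_zero_norm (fun r => hC _ (hle r) _) ?_
      have : Continuous fun r : ℝ => C * ‖S.op r.toNNReal x - S.op s.toNNReal x‖ :=
        ((((S.continuous_orbit x).comp (by fun_prop)).sub continuous_const).norm).const_mul C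
      simpa using this.tendsto s
    have := h1.add h2
    simpa [ContinuousAt, hf] using this
  have hder : ∀ s ∈ Ico (0 : ℝ) t, HasDerivWithinAt f 0 (Ici s) s := by
    intro s hs
    rw [hasDerivWithinAt_iff_tendsto_slope, Ici_sdiff_left]
    have hu := S.op_mem_generator hxy s.toNNReal
    have hu' := hu
    rw [← h] at hu'
    change Tendsto _ _ _ at hu hu'
    have hdiff := hu.sub hu'
    rw [sub_self] at hdiff
    have hmap : Tendsto (fun r : ℝ => (r - s).toNNReal) (𝓝[>] s) (𝓝[>] 0) := by
      refine tendsto_nhdsWithin_iff.2 ⟨?_, ?_⟩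
      · have : Continuous fun r : ℝ => (r - s).toNNReal := by fun_prop
        have := this.tendsto s
        simp only [sub_self, Real.toNNReal_zero] at this
        exact this.mono_left nhdsWithin_le_nhds
      · filter_upwards [self_mem_nhdsWithin] with r hr
        simpa using hr
    have h0 := (hdiff.comp hmap).norm.const_mul C
    rw [norm_zero, mul_zero] at h0
    refine squeeze_zero_norm' ?_ h0
    filter_upwards [self_mem_nhdsWithin, Ioo_mem_nhdsGT hs.2] with r hr hrt
    have hpos : 0 < r - s := sub_pos.2 hr
    have e1 : r.toNNReal = (r - s).toNNReal + s.toNNReal := by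
      rw [← Real.toNNReal_add hpos.le hs.1, sub_add_cancel]
    have e2 : t - s.toNNReal = (t - r.toNNReal) + (r - s).toNNReal := by
      have : r.toNNReal ≤ t := by
        rw [Real.toNNReal_le_iff_le_coe]; exact hrt.2.le
      apply NNReal.eq
      rw [NNReal.coe_add, NNReal.coe_sub this, NNReal.coe_sub ((Real.toNNReal_le_toNNReal
        (le_of_lt hr)).trans this), e1, NNReal.coe_add]
      ring
    have e3 : f r - f s = T.op (t - r.toNNReal)
        (S.op (r - s).toNNReal (S.op s.toNNReal x) - T.op (r - s).toNNReal (S.op s.toNNReal x)) := by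
      simp only [hf]
      rw [map_sub, e2, T.op_add, ContinuousLinearMap.comp_apply]
      congr 2
      conv_lhs => rw [e1, S.op_add]
      rfl
    rw [slope_def_module, e3, ← map_smul]
    refine (hC _ (hle r) _).trans_eq ?_
    simp only [Function.comp, ← smul_sub, sub_sub_sub_cancel_right, Real.coe_toNNReal _ hpos.le]
  have := constant_of_has_deriv_right_zero hcont.continuousOn hder t (right_mem_Icc.2 t.2)
  simp only [hf, Real.toNNReal_coe, tsub_self, T.op_zero, Real.toNNReal_zero, tsub_zero,
    S.op_zero] at this
  exact this.symm

end StronglyContinuousSemigroup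

/-! ### The Krein–Feller equation in integrated form -/

section Potential

/-- The potential `x ↦ ∫ min(x, y) w(y) dμ(y)`. -/
noncomputable def minPot (μ : Measure I) (w : I → ℝ) (x : ℝ) : ℝ := ∫ y : I, min x y * w y ∂μ

/-- The tail integral `t ↦ ∫_{(t,1]} w dμ`. -/
noncomputable def tailInt (μ : Measure I) (w : I → ℝ) (t : ℝ) : ℝ :=
  ∫ y : I, {y : I | t < y}.indicator w y ∂μ

/-- `f` is a solution of `-Δ_μ f = w` with boundary condition `b`, in integrated form. -/
def IsPotential (b : BoundaryCondition) (μ : Measure I) (w f : I → ℝ) : Prop :=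
  ∃ α β : ℝ, (∀ x : I, f x = α + β * x + minPot μ w x) ∧
    match b with
    | .neumann => β = 0 ∧ ∫ y, w y ∂μ = 0
    | .dirichlet => f 0 = 0 ∧ f 1 = 0

variable {μ : Measure I} {w : I → ℝ}

theorem measurableSet_setOf_lt_coe (t : ℝ) : MeasurableSet {y : I | t < y} :=
  measurableSet_lt measurable_const measurable_subtype_coe

theorem ae_coe_ne [NullSingletonClass μ] (t : ℝ) : ∀ᵐ y : I ∂μ, (y : ℝ) ≠ t := by
  by_cases h : t ∈ I
  · filter_upwards [measure_eq_zero_iff_ae_notMem.1 (measure_singleton (μ := μ) (⟨t, h⟩ : I))]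
      with y hy hyt
    exact hy (Subtype.ext hyt)
  · exact Eventually.of_forall fun y hy => h (hy ▸ y.2)

theorem eventually_lt_iff {t₀ y : ℝ} (h : y ≠ t₀) : ∀ᶠ t in 𝓝 t₀, (t < y ↔ t₀ < y) := by
  rcases lt_or_gt_of_ne h with h | h
  · filter_upwards [lt_mem_nhds h] with t ht
    exact iff_of_false ht.le.not_gt h.le.not_gt
  · filter_upwards [gt_mem_nhds h] with t ht
    exact iff_of_true ht h

/-- The tail could jump only at an atom. -/
theorem continuous_tailInt [NullSingletonClass μ] (hw : Integrable w μ) :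
    Continuous (tailInt μ w) := by
  rw [continuous_iff_continuousAt]
  intro t₀
  refine continuousAt_of_dominated (bound := fun y => ‖w y‖) (Eventually.of_forall fun t =>
    hw.1.indicator (measurableSet_setOf_lt_coe t)) (Eventually.of_forall fun t =>
    Eventually.of_forall fun y => norm_indicator_le_norm_self _ _) hw.norm ?_
  filter_upwards [ae_coe_ne (μ := μ) t₀] with y hy
  refine (continuousAt_const (y := {y : I | t₀ < y}.indicator w y)).congr ?_
  filter_upwards [eventually_lt_iff hy] with t ht
  by_cases h : t₀ < y
  · simp [h, ht.2 h]
  · simp [h, mt ht.1 h]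

/-- Differentiation of truncated pairings; this replaces integration by parts. -/
theorem hasDerivAt_integral_comp_min [NullSingletonClass μ] (hw : Integrable w μ) {v v' : ℝ → ℝ}
    (hv : ∀ x, HasDerivAt v (v' x) x) (hv' : Continuous v') (x : ℝ) :
    HasDerivAt (fun x => ∫ y : I, v (min x y) * w y ∂μ) (v' x * tailInt μ w x) x := by
  have hvc : Continuous v := continuous_iff_continuousAt.2 fun x => (hv x).continuousAt
  obtain ⟨C, hC⟩ := (isCompact_Icc (a := -(|x| + 1)) (b := |x| + 2)).exists_bound_of_continuousOn
    hv'.continuousOn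
  have hmem : ∀ z ∈ Metric.ball x 1, ∀ y : I, min z (y : ℝ) ∈ Icc (-(|x| + 1)) (|x| + 2) := by
    intro z hz y
    rw [Metric.mem_ball, Real.dist_eq, abs_lt] at hz
    have := y.2.1
    have := neg_abs_le x
    have := le_abs_self x
    exact ⟨le_min (by linarith) (by linarith [abs_nonneg x]), (min_le_left _ _).trans (by linarith)⟩
  have hmeas : ∀ z : ℝ, AEStronglyMeasurable (fun y : I => v (min z y) * w y) μ := fun z =>
    (Continuous.aestronglyMeasurable (by fun_prop)).mul hw.1
  have e : v' x * tailInt μ w x = ∫ y : I, {y : I | x < y}.indicator (fun y => v' x * w y) y ∂μ := by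
    rw [tailInt, ← integral_const_mul]
    congr 1 with y
    by_cases h : x < y <;> simp [h]
  rw [e]
  refine (hasDerivAt_integral_of_dominated_loc_of_lip (μ := μ) (bound := fun y => C * ‖w y‖)
    (F := fun x (y : I) => v (min x y) * w y) (Metric.ball_mem_nhds x one_pos)
    (Eventually.of_forall hmeas) ?_ ?_ ?_ (hw.norm.const_mul C) ?_).2
  · obtain ⟨D, hD⟩ := (isCompact_Icc (a := -(|x| + 1)) (b := |x| + 2)).exists_bound_of_continuousOn
      hvc.continuousOn
    exact hw.bdd_mul (Continuous.aestronglyMeasurable (by fun_prop)) (Eventually.of_forall fun y =>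
      hD _ (hmem x (Metric.mem_ball_self one_pos) y))
  · exact (hw.1.const_mul _).indicator (measurableSet_setOf_lt_coe x)
  · refine Eventually.of_forall fun y => LipschitzOnWith.of_dist_le_mul fun z hz z' hz' => ?_
    have h1 := (convex_Icc (-(|x| + 1)) (|x| + 2)).norm_image_sub_le_of_norm_hasDerivWithin_le
      (fun s _ => (hv s).hasDerivWithinAt) hC (hmem z' hz' y) (hmem z hz y)
    have h2 : |min z (y : ℝ) - min z' y| ≤ |z - z'| := by
      refine (abs_min_sub_min_le_max z y z' y).trans ?_
      simp
    have hC0 : 0 ≤ C := (norm_nonneg _).trans (hC _ (hmem z hz y))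
    rw [dist_eq_norm, dist_eq_norm, ← sub_mul, norm_mul, Real.coe_nnabs,
      abs_of_nonneg (by positivity)]
    rw [Real.norm_eq_abs (min z (y : ℝ) - _)] at h1
    calc _ ≤ C * |z - z'| * ‖w y‖ := by gcongr; exact h1.trans (by gcongr)
      _ = _ := by rw [Real.norm_eq_abs (z - z')]; ring
  -- The integrand has a kink at x only for y = x, which is a null event.
  · filter_upwards [ae_coe_ne (μ := μ) x] with y hy
    rcases lt_or_gt_of_ne hy with h | h
    · have : (fun z => v (min z y) * w y) =ᶠ[𝓝 x] fun _ => v y * w y := by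
        filter_upwards [lt_mem_nhds h] with z hz
        rw [min_eq_right hz.le]
      simpa [h.le, not_lt.2 h.le] using (hasDerivAt_const x (v y * w y)).congr_of_eventuallyEq this
    · have : (fun z => v (min z y) * w y) =ᶠ[𝓝 x] fun z => v z * w y := by
        filter_upwards [gt_mem_nhds h] with z hz
        rw [min_eq_left hz.le]
      have h2 := ((hv x).mul_const (w y)).congr_of_eventuallyEq this
      simpa [h] using h2

theorem hasDerivAt_minPot [NullSingletonClass μ] (hw : Integrable w μ) (x : ℝ) :
    HasDerivAt (minPot μ w) (tailInt μ w x) x := by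
  have := hasDerivAt_integral_comp_min hw (v := id) (v' := fun _ => 1) hasDerivAt_id
    continuous_const x
  rw [one_mul] at this
  exact this

theorem hasDerivAt_affine_add_minPot [NullSingletonClass μ] (hw : Integrable w μ) (α β x : ℝ) :
    HasDerivAt (fun x => α + β * x + minPot μ w x) (β + tailInt μ w x) x := by
  have := (((hasDerivAt_id x).const_mul β).const_add α).add (hasDerivAt_minPot hw x)
  rw [mul_one] at this
  exact this

theorem minPot_zero : minPot μ w 0 = 0 := by
  have : ∀ y : I, min (0 : ℝ) y = 0 := fun y => min_eq_left y.2.1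
  simp [minPot, this]

theorem integrable_min_mul [IsFiniteMeasure μ] (hw : Integrable w μ) (x : ℝ) :
    Integrable (fun y : I => min x y * w y) μ :=
  hw.bdd_mul (c := |x| + 1) (Continuous.aestronglyMeasurable (by fun_prop))
    (Eventually.of_forall fun y => by
      rw [Real.norm_eq_abs]
      refine (abs_min_le_max_abs_abs).trans (max_le (by linarith) ?_)
      rw [abs_of_nonneg y.2.1]
      linarith [y.2.2, abs_nonneg x])

theorem minPot_congr {w' : I → ℝ} (h : w =ᵐ[μ] w') (x : ℝ) : minPot μ w x = minPot μ w' x :=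
  integral_congr_ae (h.mono fun y hy => by simp only [hy])

theorem minPot_add [IsFiniteMeasure μ] {w' : I → ℝ} (hw : Integrable w μ) (hw' : Integrable w' μ)
    (x : ℝ) : minPot μ (fun y => w y + w' y) x = minPot μ w x + minPot μ w' x := by
  simp only [minPot, mul_add]
  exact integral_add (integrable_min_mul hw x) (integrable_min_mul hw' x)

theorem minPot_const_mul (c x : ℝ) : minPot μ (fun y => c * w y) x = c * minPot μ w x := by
  simp only [minPot, mul_left_comm _ c]
  exact integral_const_mul _ _

theorem tailInt_eq (hw : Integrable w μ) (x : I) :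
    tailInt μ w x = ∫ y, w y ∂μ - ∫ y in Iic x, w y ∂μ := by
  have h1 : {y : I | (x : ℝ) < y} = (Iic x)ᶜ := by ext y; simp
  rw [tailInt, integral_indicator (measurableSet_setOf_lt_coe _), h1]
  have := integral_add_compl (measurableSet_Iic (a := x)) hw
  linarith

theorem abs_minPot_sub_le (hw : Integrable w μ) [IsFiniteMeasure μ] (x y : ℝ) :
    |minPot μ w x - minPot μ w y| ≤ (∫ z, |w z| ∂μ) * |x - y| := by
  rw [minPot, minPot, ← integral_sub (integrable_min_mul hw x) (integrable_min_mul hw y),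
    ← integral_mul_const]
  rw [← Real.norm_eq_abs]
  refine norm_integral_le_of_norm_le (hw.abs.mul_const _) (Eventually.of_forall fun z => ?_)
  rw [← sub_mul, norm_mul, Real.norm_eq_abs, Real.norm_eq_abs, mul_comm]
  refine mul_le_mul_of_nonneg_left ?_ (abs_nonneg _)
  refine (abs_min_sub_min_le_max x z y z).trans ?_
  simp

namespace IsPotential

variable {b : BoundaryCondition} {f : I → ℝ}

theorem congr {w' : I → ℝ} (h : IsPotential b μ w f) (hw : w =ᵐ[μ] w') : IsPotential b μ w' f := by
  obtain ⟨α, β, h1, h2⟩ := h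
  refine ⟨α, β, fun x => (h1 x).trans (by rw [minPot_congr hw]), ?_⟩
  cases b
  · exact ⟨h2.1, (integral_congr_ae hw).symm.trans h2.2⟩
  · exact h2

theorem add [IsFiniteMeasure μ] {w' f' : I → ℝ} (hw : Integrable w μ) (hw' : Integrable w' μ)
    (h : IsPotential b μ w f) (h' : IsPotential b μ w' f') :
    IsPotential b μ (fun y => w y + w' y) (fun y => f y + f' y) := by
  obtain ⟨α, β, h1, h2⟩ := h
  obtain ⟨α', β', h1', h2'⟩ := h'
  refine ⟨α + α', β + β', fun x => ?_, ?_⟩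
  · simp only [h1, h1', minPot_add hw hw']; ring
  · cases b
    · exact ⟨by rw [h2.1, h2'.1, add_zero], by rw [integral_add hw hw', h2.2, h2'.2, add_zero]⟩
    · exact ⟨by simp only [h2.1, h2'.1, add_zero], by simp only [h2.2, h2'.2, add_zero]⟩

theorem const_mul (h : IsPotential b μ w f) (c : ℝ) :
    IsPotential b μ (fun y => c * w y) (fun y => c * f y) := by
  obtain ⟨α, β, h1, h2⟩ := h
  refine ⟨c * α, c * β, fun x => ?_, ?_⟩
  · simp only [h1, minPot_const_mul]; ring
  · cases b
    · exact ⟨by rw [h2.1, mul_zero], by rw [integral_const_mul, h2.2, mul_zero]⟩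
    · exact ⟨by simp only [h2.1, mul_zero], by simp only [h2.2, mul_zero]⟩

theorem boundary (h : IsPotential b μ w f) (hb : b = .dirichlet) : f 0 = 0 ∧ f 1 = 0 := by
  subst hb
  obtain ⟨α, β, h1, h2⟩ := h
  exact h2

/-- Testing the equation `-Δ f = w` with a monotone function of `f`. -/
theorem integral_comp_mul_nonneg [NullSingletonClass μ] (hw : Integrable w μ)
    (h : IsPotential b μ w f) {φ φ' : ℝ → ℝ} (hφ : ∀ x, HasDerivAt φ (φ' x) x)
    (hφ' : Continuous φ') (hφ0 : ∀ x, 0 ≤ φ' x) (h0 : φ 0 = 0) :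
    0 ≤ ∫ y, φ (f y) * w y ∂μ := by
  obtain ⟨α, β, h1, h2⟩ := h
  set F : ℝ → ℝ := fun x => α + β * x + minPot μ w x with hF
  have hFd : ∀ x, HasDerivAt F (β + tailInt μ w x) x := 
    hasDerivAt_affine_add_minPot hw α β
  have hv : ∀ x, HasDerivAt (fun x => φ (F x)) (φ' (F x) * (β + tailInt μ w x)) x := fun x =>
    (hφ (F x)).comp x (hFd x)
  have hFc : Continuous F := continuous_iff_continuousAt.2 fun x => (hFd x).continuousAt
  have hΦ := hasDerivAt_integral_comp_min hw hv
    ((hφ'.comp hFc).mul (continuous_const.add (continuous_tailInt hw)))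
  have hΨ := fun x => (hΦ x).add ((hv x).const_mul β)
  -- With v = φ ∘ F and F' = β + tail, the derivative is φ'(F) (β + tail)² ≥ 0: the energy density.
  -- Comparing the values at 0 and 1 gives the claim, since the boundary terms vanish: β = 0 and ∫ w
  -- = 0 for Neumann, φ(0) = 0 for Dirichlet.
  have hmono : Monotone fun x : ℝ => (∫ y : I, φ (F (min x y)) * w y ∂μ) + β * φ (F x) := by
    refine monotone_of_hasDerivAt_nonneg hΨ fun x => ?_
    have := mul_nonneg (hφ0 (F x)) (sq_nonneg (β + tailInt μ w x))
    change (0 : ℝ) ≤ _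
    linarith
  have h01 := hmono zero_le_one
  have e1 : ∀ y : I, min (1 : ℝ) y = y := fun y => min_eq_right y.2.2
  have e0 : ∀ y : I, min (0 : ℝ) y = 0 := fun y => min_eq_left y.2.1
  have hf : ∀ y : I, f y = F y := h1
  have hf0 : f 0 = F 0 := h1 0
  have hf1 : f 1 = F 1 := h1 1
  simp only [e1, e0, integral_const_mul, ← hf, ← hf0, ← hf1] at h01
  cases b
  · simpa [h2.1, h2.2] using h01
  · simpa [h2.1, h2.2, h0] using h01

end IsPotential

/-- With w = -g one has f' = β + tail of w. The tail vanishes at 1 and equals ∫ w at 0, so β =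
f'(1), and the two Neumann conditions amount to β = 0 and ∫ w = 0. -/
theorem mem_kreinFeller_iff {b : BoundaryCondition} [IsFiniteMeasure μ] [NullSingletonClass μ]
    (u g : L2 μ) : (u, g) ∈ kreinFeller b μ ↔
      ∃ f : I → ℝ, IsPotential b μ (fun y => -1 * g y) f ∧ u =ᵐ[μ] f := by
  have hg : Integrable g μ := (Lp.memLp g).integrable (by norm_num)
  have hg' : Integrable (fun y => -1 * g y) μ := hg.const_mul _
  have htail : ∀ x : I, tailInt μ (fun y => -1 * g y) x = ∫ y in Iic x, g y ∂μ - ∫ y, g y ∂μ := by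
    intro x
    rw [tailInt_eq hg', integral_const_mul, integral_const_mul]; ring
  have hI1 : ∫ y in Iic (1 : I), g y ∂μ = ∫ y, g y ∂μ := by
    have : Iic (1 : I) = univ := by ext y; exact iff_of_true y.2.2 trivial
    rw [this, setIntegral_univ]
  have hI0 : ∫ y in Iic (0 : I), g y ∂μ = 0 := by
    have : Iic (0 : I) = {0} := by
      ext y
      simp
    rw [this, Measure.restrict_singleton, measure_singleton]; simp
  constructor
  · rintro ⟨f, ⟨hf, hd⟩, hb, hu⟩
    refine ⟨fun x => f x, ?_, hu⟩
    have hd1 := hd 1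
    rw [hI1] at hd1
    refine ⟨f 0, derivWithin f (Icc 0 1) 1, ?_, ?_⟩
    · set F : ℝ → ℝ := fun x => f 0 + derivWithin f (Icc 0 1) 1 * x +
        minPot μ (fun y => -1 * g y) x with hF
      have hFd : ∀ x, HasDerivAt F (derivWithin f (Icc 0 1) 1 +
          tailInt μ (fun y => -1 * g y) x) x := 
        hasDerivAt_affine_add_minPot hg' _ _
      have key := eq_of_derivWithin_eq (a := 0) (b := 1) (f := f) (g := F)
        (hf.differentiableOn one_ne_zero) (fun x _ => (hFd x).differentiableAt.differentiableWithinAt)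
        (fun x hx => by
          have hx' : x ∈ Icc (0 : ℝ) 1 := ⟨hx.1, hx.2.le⟩
          rw [(hFd x).hasDerivWithinAt.derivWithin (uniqueDiffOn_Icc zero_lt_one x hx'),
            htail ⟨x, hx'⟩, hd ⟨x, hx'⟩]
          simp only [Set.Icc.coe_one] at hd1
          rw [hd1]; ring) (by simp [hF, minPot_zero])
      exact fun x => key x x.2
    · cases b
      · refine ⟨hb.2, ?_⟩
        have h0 := hb.1
        have h1 := hb.2
        simp only [Set.Icc.coe_one] at hd1
        rw [integral_const_mul]
        linarith
      · exact hb
  · rintro ⟨f, ⟨α, β, h1, h2⟩, hu⟩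
    set F : ℝ → ℝ := fun x => α + β * x + minPot μ (fun y => -1 * g y) x with hF
    have hFd : ∀ x, HasDerivAt F (β + tailInt μ (fun y => -1 * g y) x) x := 
      hasDerivAt_affine_add_minPot hg' α β
    have hder : ∀ x : I, derivWithin F (Icc 0 1) x =
        β + (∫ y in Iic x, g y ∂μ - ∫ y, g y ∂μ) := fun x => by
      rw [(hFd x).hasDerivWithinAt.derivWithin (uniqueDiffOn_Icc zero_lt_one x x.2), htail]
    have hder0 := hder 0
    have hder1 := hder 1
    rw [hI0] at hder0
    rw [hI1] at hder1
    simp only [Set.Icc.coe_one, Set.Icc.coe_zero] at hder0 hder1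
    refine ⟨F, ⟨?_, fun x => ?_⟩, ?_, hu.trans (Eventually.of_forall h1)⟩
    · refine (contDiff_one_iff_deriv.2 ⟨fun x => (hFd x).differentiableAt, ?_⟩).contDiffOn
      rw [funext fun x => (hFd x).deriv]
      exact continuous_const.add (continuous_tailInt hg')
    · rw [hder, hder0]; ring
    · cases b
      · have h2' := h2.2
        rw [integral_const_mul] at h2'
        have h3 := h2.1
        exact ⟨by rw [hder0]; linarith, by rw [hder1]; linarith⟩
      · exact ⟨(h1 0).symm.trans h2.1, (h1 1).symm.trans h2.2⟩

end Potential

/-! ### Functions linear on the gaps of a closed set -/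

section Gaps

/-- Without existential quantifiers or division, the condition is visibly linear and closed under
pointwise limits. -/
theorem linearOnGaps_iff {K : Set I} {f : I → ℝ} : LinearOnGaps K f ↔
    ∀ a b : I, a < b → Disjoint (Ioo a b) K → ∀ x ∈ Icc a b,
      ((b : ℝ) - a) * f x = (b - x) * f a + (x - a) * f b := by
  constructor
  · intro h a b hab hd x hx
    obtain ⟨c, d, hcd⟩ := h a b hab hd
    rw [hcd x hx, hcd a (left_mem_Icc.2 hab.le), hcd b (right_mem_Icc.2 hab.le)]
    ring
  · intro h a b hab hd
    have hpos : (0 : ℝ) < b - a := sub_pos.2 hab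
    refine ⟨(b * f a - a * f b) / (b - a), (f b - f a) / (b - a), fun x hx => ?_⟩
    have := h a b hab hd x hx
    field_simp
    linarith

theorem LinearOnGaps.add {K : Set I} {f g : I → ℝ} (hf : LinearOnGaps K f)
    (hg : LinearOnGaps K g) : LinearOnGaps K (fun x => f x + g x) := by
  rw [linearOnGaps_iff] at *
  intro a b hab hd x hx
  linear_combination hf a b hab hd x hx + hg a b hab hd x hx

theorem LinearOnGaps.const_mul {K : Set I} {f : I → ℝ} (hf : LinearOnGaps K f) (c : ℝ) :
    LinearOnGaps K (fun x => c * f x) := by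
  rw [linearOnGaps_iff] at *
  intro a b hab hd x hx
  linear_combination c * hf a b hab hd x hx

theorem LinearOnGaps.mono {K L : Set I} {f : I → ℝ} (hf : LinearOnGaps K f) (h : K ⊆ L) :
    LinearOnGaps L f := fun a b hab hd => hf a b hab (hd.mono_right h)

theorem exists_gap {K : Set I} (hK : IsClosed K) (h0 : 0 ∈ K) (h1 : 1 ∈ K) (x : I) :
    ∃ l ∈ K, ∃ r ∈ K, x ∈ Icc l r ∧ Disjoint (Ioo l r) K := by
  obtain ⟨l, hl, hlm⟩ := (hK.isCompact.inter_right (isClosed_Iic (a := x))).exists_isGreatest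
    ⟨0, h0, x.2.1⟩
  obtain ⟨r, hr, hrm⟩ := (hK.isCompact.inter_right (isClosed_Ici (a := x))).exists_isLeast
    ⟨1, h1, x.2.2⟩
  refine ⟨l, hl.1, r, hr.1, ⟨hl.2, hr.2⟩, disjoint_left.2 fun y hy hyK => ?_⟩
  rcases le_total y x with h | h
  · exact absurd (hlm ⟨hyK, h⟩) (not_le.2 hy.1)
  · exact absurd (hrm ⟨hyK, h⟩) (not_le.2 hy.2)

theorem LinearOnGaps.le_of_le {K : Set I} (hK : IsClosed K) (h0 : 0 ∈ K) (h1 : 1 ∈ K) {f : I → ℝ}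
    (hf : LinearOnGaps K f) {M : ℝ} (hM : ∀ x ∈ K, f x ≤ M) (x : I) : f x ≤ M := by
  obtain ⟨l, hl, r, hr, hx, hd⟩ := exists_gap hK h0 h1 x
  rcases eq_or_lt_of_le (hx.1.trans hx.2) with h | h
  · have : x = l := le_antisymm (h ▸ hx.2) hx.1
    exact this ▸ hM l hl
  · have e := linearOnGaps_iff.1 hf l r h hd x hx
    have hpos : (0 : ℝ) < r - l := sub_pos.2 h
    have h3 : (0 : ℝ) ≤ r - x := sub_nonneg.2 hx.2
    have h4 : (0 : ℝ) ≤ x - l := sub_nonneg.2 hx.1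
    refine le_of_mul_le_mul_left (a := (r : ℝ) - l) ?_ hpos
    rw [e]
    nlinarith [mul_le_mul_of_nonneg_left (hM l hl) h3, mul_le_mul_of_nonneg_left (hM r hr) h4]

theorem LinearOnGaps.eq_of_eqOn {K : Set I} (hK : IsClosed K) (h0 : 0 ∈ K) (h1 : 1 ∈ K)
    {f g : I → ℝ} (hf : LinearOnGaps K f) (hg : LinearOnGaps K g) (h : EqOn f g K) : f = g := by
  funext x
  have h2 := (hf.add (hg.const_mul (-1))).le_of_le hK h0 h1 (M := 0) (fun x hx => by
    rw [h hx]; simp) x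
  have h3 := (hg.add (hf.const_mul (-1))).le_of_le hK h0 h1 (M := 0) (fun x hx => by
    rw [h hx]; simp) x
  linarith

theorem isClosed_setOf_linearOnGaps (K : Set I) : IsClosed {f : C(I, ℝ) | LinearOnGaps K f} := by
  simp only [linearOnGaps_iff, ofPred_forall]
  refine isClosed_iInter fun a => isClosed_iInter fun b => isClosed_iInter fun _ =>
    isClosed_iInter fun _ => isClosed_iInter fun x => isClosed_iInter fun _ => ?_
  exact isClosed_eq (by fun_prop) (by fun_prop)

/-- The continuous functions which are linear on the gaps of `supp μ` and satisfy the Dirichlet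
boundary conditions if required. -/
def gapSpace (b : BoundaryCondition) (μ : Measure I) : Submodule ℝ C(I, ℝ) where
  carrier := {f | LinearOnGaps μ.support f ∧ (b = .dirichlet → f 0 = 0 ∧ f 1 = 0)}
  zero_mem' := ⟨fun _ _ _ _ => ⟨0, 0, by simp⟩, by simp⟩
  add_mem' := by
    rintro f g ⟨h1, h2⟩ ⟨h3, h4⟩
    exact ⟨h1.add h3, fun hb => by simp [h2 hb, h4 hb]⟩
  smul_mem' := by
    rintro c f ⟨h1, h2⟩
    exact ⟨h1.const_mul c, fun hb => by simp [h2 hb]⟩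

theorem isClosed_gapSpace (b : BoundaryCondition) (μ : Measure I) :
    IsClosed (gapSpace b μ : Set C(I, ℝ)) := by
  have : (gapSpace b μ : Set C(I, ℝ)) = {f : C(I, ℝ) | LinearOnGaps μ.support f} ∩
      {f : C(I, ℝ) | b = .dirichlet → f 0 = 0 ∧ f 1 = 0} := rfl
  rw [this]
  refine (isClosed_setOf_linearOnGaps _).inter ?_
  simp only [ofPred_forall]
  exact isClosed_iInter fun _ =>
    (isClosed_eq (by fun_prop) (by fun_prop)).inter (isClosed_eq (by fun_prop) (by fun_prop))

end Gaps

/-! ### The maximum principle -/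

section MaximumPrinciple

variable {μ : Measure I}

theorem le_on_support_of_ae_le {f : I → ℝ} (hf : Continuous f) {M : ℝ} (h : ∀ᵐ x ∂μ, f x ≤ M) :
    ∀ x ∈ μ.support, f x ≤ M := by
  intro x hx
  by_contra hM
  have h1 : IsOpen {x | M < f x} := isOpen_lt continuous_const hf
  have h2 : μ {x | M < f x} = 0 := by
    simpa [ae_iff] using h
  exact Measure.subset_compl_support_of_isOpen h1 h2 (not_le.1 hM) hx

theorem eqOn_support_of_ae_eq {f g : I → ℝ} (hf : Continuous f) (hg : Continuous g)
    (h : f =ᵐ[μ] g) : EqOn f g μ.support := by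
  intro x hx
  have h1 := le_on_support_of_ae_le (hf.sub hg) (M := 0)
    (h.mono fun x hx => by simp [hx]) x hx
  have h2 := le_on_support_of_ae_le (hg.sub hf) (M := 0)
    (h.mono fun x hx => by simp [hx]) x hx
  simp only [Pi.sub_apply] at h1 h2
  linarith

variable {b : BoundaryCondition} {w f : I → ℝ}

theorem IsPotential.continuous [NullSingletonClass μ] (hw : Integrable w μ)
    (h : IsPotential b μ w f) : Continuous f := by
  obtain ⟨α, β, h1, _⟩ := h
  rw [funext h1]
  have : Continuous (minPot μ w) := continuous_iff_continuousAt.2 fun x =>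
    (hasDerivAt_minPot hw x).continuousAt
  fun_prop

/-- A gap (p, q) carries no mass. For x in [p, q] the kernel min(x, y) is y for the mass to the left
and x for the mass to the right, hence affine in x. -/
theorem IsPotential.linearOnGaps [IsFiniteMeasure μ] (hw : Integrable w μ)
    (h : IsPotential b μ w f) : LinearOnGaps μ.support f := by
  obtain ⟨α, β, h1, _⟩ := h
  intro p q hpq hd
  have hnull : ∀ᵐ y ∂μ, y ∉ Ioo p q := by
    filter_upwards [Measure.support_mem_ae (μ := μ)] with y hy hy'
    exact disjoint_left.1 hd hy' hy
  -- Here min 1 y is y, written so that `integrable_min_mul` applies.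
  have hi1 : Integrable (fun y : I => (Iic p).indicator (fun y => min 1 (y : ℝ) * w y) y) μ :=
    (integrable_min_mul hw 1).indicator measurableSet_Iic
  have hi2 : Integrable (fun y : I => (Iic p)ᶜ.indicator w y) μ :=
    hw.indicator measurableSet_Iic.compl
  refine ⟨α + ∫ y, (Iic p).indicator (fun y => min 1 (y : ℝ) * w y) y ∂μ,
    β + ∫ y, (Iic p)ᶜ.indicator w y ∂μ, fun x hx => ?_⟩
  have e : minPot μ w x = ∫ y, (Iic p).indicator (fun y => min 1 (y : ℝ) * w y) y ∂μ +
      x * ∫ y, (Iic p)ᶜ.indicator w y ∂μ := by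
    rw [← integral_const_mul, ← integral_add hi1 (hi2.const_mul _)]
    refine integral_congr_ae ?_
    filter_upwards [hnull] with y hy
    by_cases hyp : y ≤ p
    · have h2 : min (x : ℝ) y = y := min_eq_right (hyp.trans hx.1)
      have h3 : min (1 : ℝ) y = y := min_eq_right y.2.2
      simp [hyp, h2, h3]
    · have hqy : q ≤ y := by
        by_contra h
        exact hy ⟨not_le.1 hyp, not_le.1 h⟩
      have h2 : min (x : ℝ) y = x := min_eq_left (hx.2.trans hqy)
      simp [not_le.1 hyp, h2, hyp]
  rw [h1, e]; ring

variable [MassDistribution μ]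

/-- The maximum principle for `λ f - Δ f = h`. -/
theorem IsPotential.le_of_le {f h : C(I, ℝ)} {l M : ℝ} (hl : 0 < l) (hM : 0 ≤ M)
    (hf : IsPotential b μ (fun y => h y - l * f y) f) (hh : ∀ x, h x ≤ l * M) (x : I) :
    f x ≤ M := by
  have hw : Integrable (fun y => h y - l * f y) μ :=
    (Continuous.integrable_of_hasCompactSupport (by fun_prop) (HasCompactSupport.of_compactSpace _))
  refine (hf.linearOnGaps hw).le_of_le Measure.isClosed_support MassDistribution.zero_mem_support
    MassDistribution.one_mem_support (le_on_support_of_ae_le f.continuous ?_) x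
  -- The test function is the squared positive part of s - M, which is C¹ and nondecreasing, and
  -- vanishes at 0 because M ≥ 0.
  have hφ : ∀ s : ℝ, HasDerivAt (fun s => max (s - M) 0 ^ 2) (2 * max (s - M) 0) s := by
    intro s
    rcases lt_trichotomy s M with hs | rfl | hs
    · have : (fun s => max (s - M) 0 ^ 2) =ᶠ[𝓝 s] fun _ => 0 := by
        filter_upwards [gt_mem_nhds hs] with r hr
        rw [max_eq_right (by linarith)]; simp
      rw [max_eq_right (by linarith), mul_zero]
      exact (hasDerivAt_const s (0 : ℝ)).congr_of_eventuallyEq this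
    · rw [hasDerivAt_iff_isLittleO]
      simp only [sub_self, max_self, mul_zero, smul_zero, sub_zero, ne_eq, OfNat.ofNat_ne_zero,
        not_false_eq_true, zero_pow]
      have : (fun r : ℝ => max (r - s) 0 ^ 2) =O[𝓝 s] fun r => ‖r - s‖ ^ 2 := by
        refine Asymptotics.isBigO_of_le _ fun r => ?_
        rw [norm_pow, norm_pow, norm_norm]
        refine pow_le_pow_left₀ (norm_nonneg _) ?_ 2
        rw [Real.norm_eq_abs, Real.norm_eq_abs, abs_of_nonneg (le_max_right _ _)]
        exact max_le (le_abs_self _) (abs_nonneg _)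
      exact this.trans_isLittleO (Asymptotics.isLittleO_pow_sub_sub s one_lt_two)
    · have : (fun s => max (s - M) 0 ^ 2) =ᶠ[𝓝 s] fun s => (s - M) ^ 2 := by
        filter_upwards [lt_mem_nhds hs] with r hr
        rw [max_eq_left (by linarith)]
      rw [max_eq_left (by linarith)]
      have h2 := ((hasDerivAt_id s).sub_const M).pow 2
      refine HasDerivAt.congr_of_eventuallyEq ?_ this
      rw [show 2 * (s - M) = (2 : ℕ) * (s - M) ^ (2 - 1) * 1 by simp]
      exact h2
  have h1 := hf.integral_comp_mul_nonneg hw hφ (by fun_prop)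
    (fun s => mul_nonneg two_pos.le (le_max_right _ _)) (by
      rw [max_eq_right (by linarith)]; simp)
  -- Where f exceeds M, h - l f ≤ l (M - f) is negative. So the tested integrand is nonpositive
  -- while its integral is nonnegative, and f ≤ M almost everywhere.
  have hle : ∀ y : I, 0 ≤ -(max (f y - M) 0 ^ 2 * (h y - l * f y)) := by
    intro y
    rcases le_total (f y) M with hy | hy
    · rw [max_eq_right (by linarith)]; simp
    · have h3 : l * M ≤ l * f y := mul_le_mul_of_nonneg_left hy hl.le
      nlinarith [hh y, sq_nonneg (max (f y - M) 0), mul_nonneg (sq_nonneg (max (f y - M) 0))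
        (show 0 ≤ l * f y - h y by linarith [hh y])]
  have hint : Integrable (fun y : I => -(max (f y - M) 0 ^ 2 * (h y - l * f y))) μ :=
    (Continuous.integrable_of_hasCompactSupport (by fun_prop) (HasCompactSupport.of_compactSpace _))
  have h2 : ∫ y, -(max (f y - M) 0 ^ 2 * (h y - l * f y)) ∂μ = 0 := by
    refine le_antisymm ?_ (integral_nonneg hle)
    rw [integral_neg]; linarith
  filter_upwards [(integral_eq_zero_iff_of_nonneg hle hint).1 h2] with y hy
  by_contra hyM
  push Not at hyM
  have h3 : l * M < l * f y := mul_lt_mul_of_pos_left hyM hl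
  have h4 := hh y
  simp only [Pi.zero_apply, neg_eq_zero, mul_eq_zero, pow_eq_zero_iff, ne_eq, OfNat.ofNat_ne_zero,
    not_false_eq_true] at hy
  rcases hy with hy | hy
  · rw [max_eq_left (by linarith)] at hy; linarith
  · linarith

theorem IsPotential.mul_norm_le {f h : C(I, ℝ)} {l : ℝ} (hl : 0 < l)
    (hf : IsPotential b μ (fun y => h y - l * f y) f) : l * ‖f‖ ≤ ‖h‖ := by
  rw [mul_comm, ← le_div_iff₀ hl, ContinuousMap.norm_le _ (by positivity)]
  have hM : 0 ≤ ‖h‖ / l := by positivity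
  have hlM : l * (‖h‖ / l) = ‖h‖ := mul_div_cancel₀ _ hl.ne'
  intro x
  rw [Real.norm_eq_abs, abs_le]
  have hneg : IsPotential b μ (fun y => (-h) y - l * (-f) y) (-f : C(I, ℝ)) := by
    have h2 := hf.const_mul (-1)
    have e1 : (fun y => (-h) y - l * (-f) y) = fun y => -1 * (h y - l * f y) := by
      funext y; simp; ring
    have e2 : (⇑(-f) : I → ℝ) = fun y => -1 * f y := by funext y; simp
    rw [e1, e2]; exact h2
  have h1 := hf.le_of_le hl hM (fun x => hlM.symm ▸ (le_abs_self _).trans (h.norm_coe_le_norm x)) x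
  have h2 := hneg.le_of_le hl hM
    (fun x => hlM.symm ▸ (neg_le_abs _).trans (h.norm_coe_le_norm x)) x
  rw [ContinuousMap.neg_apply] at h2
  exact ⟨by linarith, h1⟩

end MaximumPrinciple

/-! ### Construction of the resolvents on L² and on C[0,1] -/

section Resolvent

theorem integrable_coe_L2 {μ : Measure I} [IsFiniteMeasure μ] (w : L2 μ) : Integrable w μ :=
  (Lp.memLp w).integrable (by norm_num)

theorem integrable_coe_C {μ : Measure I} [IsFiniteMeasure μ] (f : C(I, ℝ)) : Integrable f μ :=
  f.continuous.integrable_of_hasCompactSupport (HasCompactSupport.of_compactSpace _)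

theorem integral_abs_le_norm {μ : Measure I} [IsProbabilityMeasure μ] (w : L2 μ) :
    ∫ y, |w y| ∂μ ≤ ‖w‖ := by
  have h1 : ∫ y, |w y| ∂μ = (eLpNorm w 1 μ).toReal := by
    rw [eLpNorm_one_eq_lintegral_enorm, ← integral_norm_eq_lintegral_enorm (Lp.aestronglyMeasurable w)]
    rfl
  rw [h1, Lp.norm_def]
  exact ENNReal.toReal_mono (Lp.eLpNorm_ne_top w)
    (eLpNorm_le_eLpNorm_of_exponent_le (by norm_num) (Lp.aestronglyMeasurable w))

/-- The inclusion of `C[0,1]` in `L²`. -/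
noncomputable abbrev toL2 (μ : Measure I) [IsFiniteMeasure μ] : C(I, ℝ) →L[ℝ] L2 μ :=
  ContinuousMap.toLp 2 μ ℝ

theorem coeFn_toL2 (μ : Measure I) [IsFiniteMeasure μ] (f : C(I, ℝ)) : toL2 μ f =ᵐ[μ] f :=
  ContinuousMap.coeFn_toLp μ f

theorem inner_toL2 {μ : Measure I} [IsFiniteMeasure μ] (f : C(I, ℝ)) (w : L2 μ) :
    inner ℝ (toL2 μ f) w = ∫ y, f y * w y ∂μ := by
  rw [L2.inner_def]
  refine integral_congr_ae ?_
  filter_upwards [coeFn_toL2 μ f] with y hy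
  rw [hy, real_inner_eq_re_inner]
  simp [mul_comm]

variable (b : BoundaryCondition) (μ : Measure I) [MassDistribution μ]

/-- Integration as a functional on `L²`. -/
noncomputable def meanL2 : L2 μ →L[ℝ] ℝ :=
  LinearMap.mkContinuous
    { toFun := fun w => ∫ y, w y ∂μ
      map_add' := fun v w => by
        rw [← integral_add (integrable_coe_L2 v) (integrable_coe_L2 w)]
        exact integral_congr_ae (Lp.coeFn_add v w)
      map_smul' := fun c w => by
        rw [RingHom.id_apply, smul_eq_mul, ← integral_const_mul]
        exact integral_congr_ae (Lp.coeFn_smul c w) } 1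
    (fun w => by
      rw [one_mul]
      exact (norm_integral_le_integral_norm _).trans (integral_abs_le_norm w))

theorem meanL2_apply (w : L2 μ) : meanL2 μ w = ∫ y, w y ∂μ := rfl

theorem meanL2_toL2 (f : C(I, ℝ)) : meanL2 μ (toL2 μ f) = ∫ y, f y ∂μ :=
  integral_congr_ae (coeFn_toL2 μ f)

/-- The potential operator `L² → C[0,1]`. -/
noncomputable def minPotL2 : L2 μ →L[ℝ] C(I, ℝ) :=
  LinearMap.mkContinuous
    { toFun := fun w => ⟨fun x => minPot μ w x, (continuous_iff_continuousAt.2 fun x =>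
        (hasDerivAt_minPot (integrable_coe_L2 w) x).continuousAt).comp continuous_subtype_val⟩
      map_add' := fun v w => by
        ext x
        exact (minPot_congr (Lp.coeFn_add v w) x).trans
          (minPot_add (integrable_coe_L2 v) (integrable_coe_L2 w) x)
      map_smul' := fun c w => by
        ext x
        exact (minPot_congr (Lp.coeFn_smul c w) x).trans (minPot_const_mul c x) } 1
    (fun w => by
      rw [one_mul, ContinuousMap.norm_le _ (norm_nonneg _)]
      intro x
      have h := abs_minPot_sub_le (integrable_coe_L2 w) x 0
      rw [minPot_zero, sub_zero, sub_zero, abs_of_nonneg x.2.1] at h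
      refine h.trans ((mul_le_of_le_one_right ?_ x.2.2).trans (integral_abs_le_norm w))
      exact integral_nonneg fun _ => abs_nonneg _)

theorem minPotL2_apply (w : L2 μ) (x : I) : minPotL2 μ w x = minPot μ w x := rfl

/-- A Green operator: up to the projection `P` on the kernel of `Δ`, it inverts `-Δ`. -/
theorem exists_green : ∃ (G : L2 μ →L[ℝ] C(I, ℝ)) (P : L2 μ →L[ℝ] ℝ),
    (∀ w, IsPotential b μ (fun y => w y - P w) (G w)) ∧ (∀ w, P (toL2 μ (G w)) = 0) ∧
    (∀ w v, P w * ∫ y, G v y ∂μ = 0) ∧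
    (∀ v f w, IsPotential b μ v f → IsPotential b μ v (fun x => f x + P w)) := by
  cases b
  -- Neumann case: E removes the mean, as solvability requires, and the potential is then normalised
  -- to mean zero.
  · set E : L2 μ →L[ℝ] L2 μ := ContinuousLinearMap.id ℝ (L2 μ) -
      (meanL2 μ).smulRight (toL2 μ 1) with hE
    have hEw : ∀ w, E w =ᵐ[μ] fun y => w y - meanL2 μ w := by
      intro w
      filter_upwards [Lp.coeFn_sub w (meanL2 μ w • toL2 μ 1),
        Lp.coeFn_smul (meanL2 μ w) (toL2 μ (1 : C(I, ℝ))), coeFn_toL2 μ (1 : C(I, ℝ))]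
        with y h1 h2 h3
      rw [Pi.sub_apply, h2, Pi.smul_apply, h3] at h1
      simpa [hE] using h1
    have hint : ∀ w : L2 μ, ∫ y, (w y - meanL2 μ w) ∂μ = 0 := by
      intro w
      rw [integral_sub (integrable_coe_L2 w) (integrable_const _), ← meanL2_apply]
      simp
    set G : L2 μ →L[ℝ] C(I, ℝ) := (minPotL2 μ).comp E -
      ((meanL2 μ).comp ((toL2 μ).comp ((minPotL2 μ).comp E))).smulRight 1 with hG
    have hGx : ∀ w x, G w x = minPot μ (E w) x - ∫ y : I, minPot μ (E w) y ∂μ := by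
      intro w x
      simp only [hG, ContinuousLinearMap.comp_apply, _root_.sub_apply,
        ContinuousLinearMap.smulRight_apply, meanL2_toL2, ContinuousMap.sub_apply, minPotL2_apply,
        ContinuousMap.smul_apply, ContinuousMap.one_apply, smul_eq_mul, mul_one]
    have hGmean : ∀ w, ∫ y, G w y ∂μ = 0 := by
      intro w
      have hi : Integrable (fun y : I => minPot μ (E w) y) μ := integrable_coe_C (minPotL2 μ (E w))
      simp only [hGx]
      rw [integral_sub hi (integrable_const _)]
      simp
    refine ⟨G, meanL2 μ, fun w => ⟨-∫ y : I, minPot μ (E w) y ∂μ, 0, fun x => ?_, rfl, hint w⟩,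
      fun w => ?_, fun w v => ?_, ?_⟩
    · rw [hGx, minPot_congr (hEw w)]; ring
    · rw [meanL2_toL2, hGmean]
    · rw [hGmean, mul_zero]
    · rintro v f w ⟨α, β, h1, h2⟩
      exact ⟨α + meanL2 μ w, β, fun x => by simp only [h1]; ring, h2⟩
  -- Dirichlet case: there is no kernel, so P = 0, and a multiple of x corrects the value at 1.
  · set idC : C(I, ℝ) := ⟨fun x => x, continuous_subtype_val⟩
    set G : L2 μ →L[ℝ] C(I, ℝ) := minPotL2 μ -
      ((ContinuousMap.evalCLM ℝ (1 : I)).comp (minPotL2 μ)).smulRight idC with hG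
    have hGx : ∀ w x, G w x = minPot μ w x - minPot μ w 1 * x := fun w x => rfl
    refine ⟨G, 0, fun w => ⟨0, -minPot μ w 1, fun x => ?_, ?_, ?_⟩, by simp, by simp, by simp⟩
    · rw [hGx]; simp; ring
    · rw [hGx]; simp [minPot_zero]
    · rw [hGx]; simp

variable {b μ}

theorem IsPotential.integral_mul_nonneg {w : I → ℝ} {f : I → ℝ} (hw : Integrable w μ)
    (hf : IsPotential b μ w f) : 0 ≤ ∫ y, f y * w y ∂μ :=
  hf.integral_comp_mul_nonneg hw (φ := id) (φ' := fun _ => 1) hasDerivAt_id continuous_const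
    (fun _ => zero_le_one) rfl

theorem integrable_mul_coe_L2 (f : C(I, ℝ)) (w : L2 μ) : Integrable (fun y => f y * w y) μ :=
  (integrable_coe_L2 w).bdd_mul (f.continuous.aestronglyMeasurable)
    (Eventually.of_forall f.norm_coe_le_norm)

variable (b μ)

/-- Since ⟨G w, w⟩ ≥ 0, the operator 1 + l G is coercive on L², hence invertible. If z + l G z = h,
then P z = P h, and f = G z + P h / l satisfies -Δ f = z - P z = h - l f. -/
theorem exists_resolvent {l : ℝ} (hl : 0 < l) : ∃ T : L2 μ →L[ℝ] C(I, ℝ),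
    ∀ h : L2 μ, IsPotential b μ (fun y => h y - l * T h y) (T h) := by
  obtain ⟨G, P, h1, h2, h3, h4⟩ := exists_green b μ
  set A : L2 μ →L[ℝ] L2 μ := ContinuousLinearMap.id ℝ (L2 μ) + l • (toL2 μ).comp G with hA
  have hpos : ∀ w, 0 ≤ inner ℝ (toL2 μ (G w)) w := by
    intro w
    have : 0 ≤ ∫ y, G w y * (w y - P w) ∂μ :=
      (h1 w).integral_mul_nonneg ((integrable_coe_L2 w).sub (integrable_const _))
    rw [inner_toL2]
    simp only [mul_sub] at this
    rw [integral_sub (integrable_mul_coe_L2 _ _) ((integrable_coe_C _).mul_const _),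
      integral_mul_const, mul_comm _ (P w), h3, sub_zero] at this
    exact this
  have hunit : IsUnit A := by
    refine ContinuousLinearMap.isUnit_of_forall_le_norm_inner_map A (c := 1) one_pos fun w => ?_
    have e : inner ℝ (A w) w = ‖w‖ ^ 2 + l * inner ℝ (toL2 μ (G w)) w := by
      simp [hA, inner_add_left, inner_smul_left]
    rw [e, NNReal.coe_one, mul_one]
    exact (le_add_of_nonneg_right (mul_nonneg hl.le (hpos w))).trans (le_abs_self _)
  obtain ⟨B, hB, -⟩ := isUnit_iff_exists.1 hunit
  refine ⟨G.comp B + (l⁻¹ • P).smulRight (1 : C(I, ℝ)), fun h => ?_⟩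
  set z := B h with hz
  have hAz : z + l • toL2 μ (G z) = h := by
    have := congrArg (fun C : L2 μ →L[ℝ] L2 μ => C h) hB
    simpa [hA] using this
  have hPz : P z = P h := by
    rw [← hAz, map_add, map_smul, h2, smul_zero, add_zero]
  have e : ∀ x, (G.comp B + (l⁻¹ • P).smulRight (1 : C(I, ℝ))) h x = G z x + P (l⁻¹ • h) := by
    intro x
    simp [hz]
  have h5 := h4 _ _ (l⁻¹ • h) (h1 z)
  rw [← funext e] at h5
  refine h5.congr ?_
  filter_upwards [Lp.coeFn_add z (l • toL2 μ (G z)), Lp.coeFn_smul l (toL2 μ (G z)),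
    coeFn_toL2 μ (G z)] with y hy1 hy2 hy3
  rw [hAz, Pi.add_apply, hy2, Pi.smul_apply, hy3, smul_eq_mul] at hy1
  rw [e, hy1, hPz, map_smul, smul_eq_mul]
  field_simp
  ring

/-- The resolvent `(λ - Δ)⁻¹` as an operator from `L²` to `C[0,1]`. -/
noncomputable def greenResolvent (l : ℝ) : L2 μ →L[ℝ] C(I, ℝ) :=
  if hl : 0 < l then (exists_resolvent b μ hl).choose else 0

theorem greenResolvent_spec {l : ℝ} (hl : 0 < l) (h : L2 μ) :
    IsPotential b μ (fun y => h y - l * greenResolvent b μ l h y) (greenResolvent b μ l h) := by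
  rw [greenResolvent, dif_pos hl]
  exact (exists_resolvent b μ hl).choose_spec h

variable {b μ}

/-- Uniqueness: the difference of two solutions solves the equation with right side 0, so the
sup-norm bound kills it. -/
theorem greenResolvent_eq {l : ℝ} (hl : 0 < l) {h : L2 μ} {f : C(I, ℝ)}
    (hf : IsPotential b μ (fun y => h y - l * f y) f) : greenResolvent b μ l h = f := by
  set g := greenResolvent b μ l h
  have hg := greenResolvent_spec b μ hl h
  have hw : ∀ k : C(I, ℝ), Integrable (fun y => h y - l * k y) μ := fun k =>
    (integrable_coe_L2 h).sub ((integrable_coe_C k).const_mul l)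
  have h1 := hg.add (hw g) ((hw f).const_mul (-1)) (hf.const_mul (-1))
  have h2 : IsPotential b μ (fun y => (0 : C(I, ℝ)) y - l * (g - f) y) (g - f : C(I, ℝ)) := by
    convert h1 using 1
    · funext y; simp; ring
    · funext y; simp [g]; ring
  have h3 := h2.mul_norm_le hl
  rw [norm_zero] at h3
  have h4 : ‖g - f‖ ≤ 0 := by
    by_contra h5
    exact absurd h3 (not_le.2 (mul_pos hl (not_le.1 h5)))
  exact sub_eq_zero.1 (norm_le_zero_iff.1 h4)

theorem greenResolvent_sub_eq {l m : ℝ} (hl : 0 < l) (hm : 0 < m) (h : L2 μ) :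
    greenResolvent b μ l h - greenResolvent b μ m h =
      (m - l) • greenResolvent b μ l (toL2 μ (greenResolvent b μ m h)) := by
  set f := greenResolvent b μ l h
  set g := greenResolvent b μ m h
  set k := greenResolvent b μ l (toL2 μ g)
  have hw : ∀ (c : ℝ) (v : L2 μ) (k : C(I, ℝ)), Integrable (fun y => v y - c * k y) μ :=
    fun c v k => (integrable_coe_L2 v).sub ((integrable_coe_C k).const_mul c)
  have h1 := (greenResolvent_spec b μ hm h).add (hw m h g) ((hw l (toL2 μ g) k).const_mul (m - l))
    ((greenResolvent_spec b μ hl (toL2 μ g)).const_mul (m - l))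
  have h2 : IsPotential b μ (fun y => h y - l * (g + (m - l) • k) y) (g + (m - l) • k : C(I, ℝ)) := by
    refine IsPotential.congr (w := fun y => h y - m * g y + (m - l) * (toL2 μ g y - l * k y)) ?_ ?_
    · exact h1
    · filter_upwards [coeFn_toL2 μ g] with y hy
      rw [hy]; simp; ring
  rw [sub_eq_iff_eq_add, add_comm]
  exact greenResolvent_eq hl h2

theorem mul_norm_greenResolvent_toL2_le {l : ℝ} (hl : 0 < l) (h : C(I, ℝ)) :
    l * ‖greenResolvent b μ l (toL2 μ h)‖ ≤ ‖h‖ := by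
  refine IsPotential.mul_norm_le hl ((greenResolvent_spec b μ hl (toL2 μ h)).congr ?_)
  filter_upwards [coeFn_toL2 μ h] with y hy
  rw [hy]

/-- Energy estimate: testing the equation with f itself gives l‖f‖² ≤ ⟨f, h⟩. -/
theorem mul_norm_toL2_greenResolvent_le {l : ℝ} (hl : 0 < l) (h : L2 μ) :
    l * ‖toL2 μ (greenResolvent b μ l h)‖ ≤ ‖h‖ := by
  set f := greenResolvent b μ l h
  have h1 : 0 ≤ ∫ y, f y * (h y - l * f y) ∂μ :=
    (greenResolvent_spec b μ hl h).integral_mul_nonneg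
      ((integrable_coe_L2 h).sub ((integrable_coe_C f).const_mul l))
  have h2 : ∫ y, f y * (h y - l * f y) ∂μ = inner ℝ (toL2 μ f) h - l * ‖toL2 μ f‖ ^ 2 := by
    rw [← real_inner_self_eq_norm_sq, inner_toL2, inner_toL2, ← integral_const_mul,
      ← integral_sub (integrable_mul_coe_L2 _ _) ((integrable_mul_coe_L2 _ _).const_mul l)]
    refine integral_congr_ae ?_
    filter_upwards [coeFn_toL2 μ f] with y hy
    rw [hy]; ring
  rw [h2] at h1
  have h3 := real_inner_le_norm (toL2 μ f) h
  rcases (norm_nonneg (toL2 μ f)).eq_or_lt with h4 | h4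
  · rw [← h4, mul_zero]; exact norm_nonneg _
  · refine le_of_mul_le_mul_left (a := ‖toL2 μ f‖) ?_ h4
    nlinarith

variable (b μ)

/-- The resolvent of the Krein–Feller operator on `L²`. -/
noncomputable def resolventL2 : ContractionResolvent (L2 μ) where
  R l := (toL2 μ).comp (greenResolvent b μ l)
  sub_eq _ _ hl hm x := by
    simp only [ContinuousLinearMap.comp_apply]
    rw [← map_sub, greenResolvent_sub_eq hl hm, map_smul]
  norm_le _ hl x := mul_norm_toL2_greenResolvent_le hl x

/-- The resolvent of the Krein–Feller operator on `C[0,1]`. -/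
noncomputable def resolventC : ContractionResolvent C(I, ℝ) where
  R l := (greenResolvent b μ l).comp (toL2 μ)
  sub_eq _ _ hl hm x := greenResolvent_sub_eq hl hm (toL2 μ x)
  norm_le _ hl x := mul_norm_greenResolvent_toL2_le hl x

/-- The inclusion of C[0,1] in L² intertwines the two resolvents. This is the bridge that identifies
sup-norm limits with the L² semigroup. -/
theorem toL2_yosida (l t : ℝ) (f : C(I, ℝ)) :
    toL2 μ ((resolventC b μ).yosida l t f) = (resolventL2 b μ).yosida l t (toL2 μ f) := by
  refine map_exp_apply (toL2 μ) (fun g => ?_) f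
  simp only [smul_apply, ContractionResolvent.gen_apply, map_smul, map_sub]
  rfl

/-- Δ u = g means u - Δ u = u - g, that is, u = R_1 (u - g). This is the form that `generator_eq`
delivers. -/
theorem kreinFeller_eq_range :
    kreinFeller b μ = range fun y => ((resolventL2 b μ).R 1 y, (resolventL2 b μ).R 1 y - y) := by
  ext ⟨u, g⟩
  rw [mem_kreinFeller_iff]
  constructor
  · rintro ⟨f, hf, hu⟩
    have hg : Integrable (fun y => -1 * g y) μ := (integrable_coe_L2 g).const_mul _
    set F : C(I, ℝ) := ⟨f, hf.continuous hg⟩ with hF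
    have hF1 : greenResolvent b μ 1 (u - g) = F := by
      refine greenResolvent_eq one_pos (hf.congr ?_)
      filter_upwards [hu, Lp.coeFn_sub u g] with y h1 h2
      rw [h2, Pi.sub_apply, h1, hF]
      simp
    have hFu : toL2 μ F = u := Lp.ext ((coeFn_toL2 μ F).trans hu.symm)
    refine ⟨u - g, ?_⟩
    change (toL2 μ (greenResolvent b μ 1 (u - g)), toL2 μ (greenResolvent b μ 1 (u - g)) - (u - g)) = _
    rw [hF1, hFu, sub_sub_cancel]
  · rintro ⟨y, hy⟩
    obtain ⟨rfl, rfl⟩ := Prod.ext_iff.1 hy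
    refine ⟨greenResolvent b μ 1 y, (greenResolvent_spec b μ one_pos y).congr ?_,
      coeFn_toL2 μ _⟩
    filter_upwards [coeFn_toL2 μ (greenResolvent b μ 1 y),
      Lp.coeFn_sub (toL2 μ (greenResolvent b μ 1 y)) y] with x h1 h2
    change _ = -1 * (toL2 μ (greenResolvent b μ 1 y) - y : L2 μ) x
    rw [h2, Pi.sub_apply, h1]; ring

end Resolvent

/-! ### Piecewise linear approximation with nodes in a closed set -/

section PiecewiseLinear

/-- The function that increases with slope one from `p` to `q` and is constant elsewhere. -/
def ramp (p q : I) : C(I, ℝ) where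
  toFun x := min (x : ℝ) q - min (x : ℝ) p
  continuous_toFun := by fun_prop

theorem ramp_apply (p q x : I) : ramp p q x = min (x : ℝ) q - min (x : ℝ) p := rfl

/-- `f` is approximated on `[0, p]` by an element of `U` which is constant on `[p, 1]`. -/
def ApproxUpTo (U : Submodule ℝ C(I, ℝ)) (f : C(I, ℝ)) (ε : ℝ) (p : I) : Prop :=
  ∃ g ∈ U, (∀ x, p ≤ x → g x = f p - f 0) ∧ ∀ x ≤ p, |f x - f 0 - g x| ≤ ε

theorem ApproxUpTo.step {U : Submodule ℝ C(I, ℝ)} {f : C(I, ℝ)} {ε : ℝ} {p q : I}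
    (h : ApproxUpTo U f ε p) (hpq : p ≤ q) (hU : ramp p q ∈ U)
    (H : p < q → ∀ x ∈ Icc p q, |f x - f p - (x - p) / (q - p) * (f q - f p)| ≤ ε) :
    ApproxUpTo U f ε q := by
  rcases hpq.eq_or_lt with rfl | hlt
  · exact h
  obtain ⟨g, hg, h1, h2⟩ := h
  have hpos : (0 : ℝ) < q - p := sub_pos.2 hlt
  refine ⟨g + ((f q - f p) / (q - p)) • ramp p q, U.add_mem hg (U.smul_mem _ hU), fun x hx => ?_,
    fun x hx => ?_⟩
  · have e1 : min (x : ℝ) q = q := min_eq_right hx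
    have e2 : min (x : ℝ) p = p := min_eq_right (hpq.trans hx)
    rw [ContinuousMap.add_apply, ContinuousMap.smul_apply, ramp_apply, e1, e2, h1 x (hpq.trans hx),
      smul_eq_mul, div_mul_cancel₀ _ hpos.ne']
    ring
  · have e1 : min (x : ℝ) q = x := min_eq_left hx
    rw [ContinuousMap.add_apply, ContinuousMap.smul_apply, ramp_apply, e1, smul_eq_mul]
    rcases le_total x p with hxp | hxp
    · have e2 : min (x : ℝ) p = x := min_eq_left hxp
      rw [e2, sub_self, mul_zero, add_zero]
      exact h2 x hxp
    · have e2 : min (x : ℝ) p = p := min_eq_right hxp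
      rw [e2, h1 x hxp]
      convert H hlt x ⟨hxp, hx⟩ using 2
      ring

/-- Piecewise linear interpolation with nodes in `K` of functions which are linear on the gaps of
`K`. -/
theorem LinearOnGaps.exists_approx {K : Set I} (hK : IsClosed K) (h0 : 0 ∈ K) (h1 : 1 ∈ K)
    {f : C(I, ℝ)} (hf : LinearOnGaps K f) {U : Submodule ℝ C(I, ℝ)}
    (hU : ∀ p ∈ K, ∀ q ∈ K, ramp p q ∈ U) {ε : ℝ} (hε : 0 < ε) :
    ∃ g ∈ U, g 1 = f 1 - f 0 ∧ ∀ x, |f x - f 0 - g x| ≤ ε := by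
  obtain ⟨δ, hδ, hfδ⟩ := Metric.uniformContinuous_iff.1
    (CompactSpace.uniformContinuous_of_continuous f.continuous) (ε / 2) (by linarith)
  have hosc : ∀ x y : I, |(x : ℝ) - y| < δ → |f x - f y| < ε / 2 := fun x y h => hfδ h
  -- The nodes advance by at least δ/2 per round, so finitely many rounds reach 1.
  have key : ∀ k : ℕ, ∃ p ∈ K, ApproxUpTo U f ε p ∧ min 1 (k * (δ / 2)) ≤ (p : ℝ) := by
    intro k
    induction k with
    | zero =>
      refine ⟨0, h0, ⟨0, U.zero_mem, fun x _ => by simp, fun x hx => ?_⟩, by simp⟩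
      have : x = 0 := le_antisymm hx x.2.1
      simp [this, hε.le]
    | succ k ih =>
      obtain ⟨p, hp, hap, hkp⟩ := ih
      set t : I := ⟨min 1 ((k + 1 : ℕ) * (δ / 2)), le_min zero_le_one (by positivity),
        min_le_left _ _⟩ with ht
      rcases le_or_gt t p with htp | htp
      · exact ⟨p, hp, hap, htp⟩
      have htp' : (t : ℝ) - p ≤ δ / 2 := by
        rw [ht]
        push_cast
        rcases min_le_iff.1 hkp with h | h
        · have := min_le_left 1 (((k : ℝ) + 1) * (δ / 2)); linarith
        · have := min_le_right 1 (((k : ℝ) + 1) * (δ / 2)); linarith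
      -- The target t may lie in a gap [l, r]. The move from p to l is shorter than δ, so uniform
      -- continuity controls the interpolation error; the move from l to r may be long, but f is
      -- affine there and the error is 0.
      obtain ⟨l, hl, r, hr, htlr, hd⟩ := exists_gap hK h0 h1 t
      have hpl : p ≤ l := by
        by_contra hlp
        exact disjoint_left.1 hd ⟨not_le.1 hlp, htp.trans_le htlr.2⟩ hp
      refine ⟨r, hr, (hap.step hpl (hU p hp l hl) fun hlt x hx => ?_).step (htlr.1.trans htlr.2)
        (hU l hl r hr) fun hlt x hx => ?_, htlr.2⟩
      · have hpos : (0 : ℝ) < l - p := sub_pos.2 hlt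
        have hl' : (l : ℝ) ≤ t := htlr.1
        have hx1 : (p : ℝ) ≤ x := hx.1
        have hx2 : (x : ℝ) ≤ l := hx.2
        have a1 := hosc x p (by rw [abs_of_nonneg (by linarith)]; linarith)
        have a2 := hosc l p (by rw [abs_of_nonneg (by linarith)]; linarith)
        have a3 : |((x : ℝ) - p) / (l - p)| ≤ 1 := by
          rw [abs_of_nonneg (div_nonneg (by linarith) hpos.le), div_le_one hpos]; linarith
        have a4 := mul_le_mul a3 a2.le (abs_nonneg _) zero_le_one
        refine (abs_sub _ _).trans ?_
        rw [abs_mul]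
        linarith
      · have hpos : (0 : ℝ) < r - l := sub_pos.2 hlt
        have e := linearOnGaps_iff.1 hf l r hlt hd x hx
        have : f x - f l - (x - l) / (r - l) * (f r - f l) = 0 := by
          field_simp
          linarith
        rw [this, abs_zero]
        exact hε.le
  obtain ⟨k, hk⟩ := exists_nat_gt (1 / (δ / 2))
  rw [div_lt_iff₀ (by linarith)] at hk
  obtain ⟨p, -, ⟨g, hg, hg1, hg2⟩, hp⟩ := key k
  rw [min_eq_left hk.le] at hp
  have hp1 : p = 1 := le_antisymm p.2.2 hp
  subst hp1
  exact ⟨g, hg, hg1 1 le_rfl, fun x => hg2 x x.2.2⟩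

end PiecewiseLinear

/-! ### The closure of the range of the resolvent contains the gap space -/

section Density

variable (b : BoundaryCondition) (μ : Measure I) [MassDistribution μ]

/-- The closure in `C[0,1]` of the range of the resolvent. -/
noncomputable def resolventClosure : Submodule ℝ C(I, ℝ) :=
  (LinearMap.range ((resolventC b μ).R 1).toLinearMap).topologicalClosure

theorem coe_resolventClosure :
    (resolventClosure b μ : Set C(I, ℝ)) = closure (range ((resolventC b μ).R 1)) := by
  rw [resolventClosure, Submodule.topologicalClosure_coe]
  congr 1

theorem greenResolvent_mem_gapSpace {l : ℝ} (hl : 0 < l) (h : L2 μ) :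
    greenResolvent b μ l h ∈ gapSpace b μ :=
  have hs := greenResolvent_spec b μ hl h
  ⟨hs.linearOnGaps ((integrable_coe_L2 h).sub ((integrable_coe_C _).const_mul l)), hs.boundary⟩

variable {b μ}

/-- Here f = R_1 (w + f) with a right side that is only in L². Continuous functions approximate it
in L², and R_1 is continuous from L² to C[0,1]. -/
theorem IsPotential.mem_resolventClosure {w : I → ℝ} (hw : MemLp w 2 μ) {f : C(I, ℝ)}
    (hf : IsPotential b μ w f) : f ∈ resolventClosure b μ := by
  have e : greenResolvent b μ 1 (hw.toLp w + toL2 μ f) = f := by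
    refine greenResolvent_eq one_pos (hf.congr ?_)
    filter_upwards [hw.coeFn_toLp, coeFn_toL2 μ f, Lp.coeFn_add (hw.toLp w) (toL2 μ f)]
      with y h1 h2 h3
    rw [h3, Pi.add_apply, h1, h2]; ring
  have hd : hw.toLp w + toL2 μ f ∈ closure (range (toL2 μ)) :=
    ContinuousMap.toLp_denseRange ℝ μ ℝ (by norm_num) _
  rw [← SetLike.mem_coe, coe_resolventClosure, ← e]
  have h2 := image_closure_subset_closure_image (greenResolvent b μ 1).continuous
    (mem_image_of_mem _ hd)
  rwa [← range_comp] at h2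

/-- The density is the normalised indicator of a small ball at p, which has positive mass because p
is in the support; min(x, ·) is 1-Lipschitz. -/
theorem exists_minPot_near {p : I} (hp : p ∈ μ.support) {ε : ℝ} (hε : 0 < ε) :
    ∃ w : I → ℝ, MemLp w 2 μ ∧ ∫ y, w y ∂μ = 1 ∧
      ∀ x : I, |minPot μ w x - min (x : ℝ) p| ≤ ε := by
  set B := Metric.ball p ε with hB
  have hBm : MeasurableSet B := Metric.isOpen_ball.measurableSet
  have hpos : 0 < μ.real B := by
    rw [Measure.real, ENNReal.toReal_pos_iff]
    exact ⟨(Measure.mem_support_iff_forall p).1 hp B (Metric.ball_mem_nhds p hε),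
      measure_lt_top μ B⟩
  set w : I → ℝ := B.indicator fun _ => (μ.real B)⁻¹ with hw
  have hwL : MemLp w 2 μ := memLp_indicator_const 2 hBm _ (Or.inr (measure_ne_top μ B))
  have hwi : Integrable w μ := hwL.integrable (by norm_num)
  have hw1 : ∫ y, w y ∂μ = 1 := by
    rw [hw, integral_indicator_const _ hBm, smul_eq_mul, mul_inv_cancel₀ hpos.ne']
  have hw0 : ∀ y, 0 ≤ w y := fun y => indicator_nonneg (fun _ _ => by positivity) y
  refine ⟨w, hwL, hw1, fun x => ?_⟩
  have e : minPot μ w x - min (x : ℝ) p = ∫ y : I, (min (x : ℝ) y - min (x : ℝ) p) * w y ∂μ := by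
    simp only [sub_mul]
    rw [integral_sub (integrable_min_mul hwi x) (hwi.const_mul _), integral_const_mul, hw1, mul_one]
    rfl
  have e2 : ε = ∫ y, ε * w y ∂μ := by rw [integral_const_mul, hw1, mul_one]
  rw [e, ← Real.norm_eq_abs]
  conv_rhs => rw [e2]
  refine norm_integral_le_of_norm_le (hwi.const_mul ε) (Eventually.of_forall fun y => ?_)
  rw [norm_mul, Real.norm_of_nonneg (hw0 y)]
  by_cases hy : y ∈ B
  · refine mul_le_mul_of_nonneg_right ?_ (hw0 y)
    refine (abs_min_sub_min_le_max _ _ _ _).trans (max_le (by simpa using hε.le) ?_)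
    exact (Metric.mem_ball.1 hy).le
  · simp [hw, hy]

variable (b μ)

/-- Subtraction of the linear function with the same value at `1` in the Dirichlet case. -/
noncomputable def boundaryCorrection : C(I, ℝ) →ₗ[ℝ] C(I, ℝ) where
  toFun f := match b with
    | .neumann => f
    | .dirichlet => f - f 1 • ⟨fun x => x, continuous_subtype_val⟩
  map_add' f g := by
    cases b
    · rfl
    · ext x; simp; ring
  map_smul' c f := by
    cases b
    · rfl
    · ext x; simp; ring

theorem norm_boundaryCorrection_le (f : C(I, ℝ)) : ‖boundaryCorrection b f‖ ≤ 2 * ‖f‖ := by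
  cases b
  · change ‖f‖ ≤ _
    linarith [norm_nonneg f]
  · refine (ContinuousMap.norm_le _ (by positivity)).2 fun x => ?_
    change ‖f x - f 1 * x‖ ≤ _
    refine (norm_sub_le _ _).trans ?_
    rw [norm_mul, Real.norm_of_nonneg x.2.1, two_mul]
    exact add_le_add (f.norm_coe_le_norm x) ((mul_le_of_le_one_right (norm_nonneg _) x.2.2).trans
      (f.norm_coe_le_norm 1))

/-- A ramp is min(x,q) - min(x,p), approximated by the potential of a difference of two unit masses.
That difference has mean zero, as Neumann requires; for Dirichlet the correction restores the
boundary values and at most doubles the error. -/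
theorem boundaryCorrection_ramp_mem {p q : I} (hp : p ∈ μ.support) (hq : q ∈ μ.support) :
    boundaryCorrection b (ramp p q) ∈ resolventClosure b μ := by
  have hcl : IsClosed (resolventClosure b μ : Set C(I, ℝ)) :=
    Submodule.isClosed_topologicalClosure _
  rw [← SetLike.mem_coe, ← hcl.closure_eq, Metric.mem_closure_iff]
  intro ε hε
  obtain ⟨v, hv, hv1, hvp⟩ := exists_minPot_near hp (show 0 < ε / 8 by linarith)
  obtain ⟨w, hw, hw1, hwq⟩ := exists_minPot_near hq (show 0 < ε / 8 by linarith)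
  have hvi : Integrable v μ := hv.integrable (by norm_num)
  have hwi : Integrable w μ := hw.integrable (by norm_num)
  have hd : MemLp (fun y => w y + -1 * v y) 2 μ := hw.add (hv.const_mul (-1))
  have hdi : Integrable (fun y => w y + -1 * v y) μ := hd.integrable (by norm_num)
  have he : ∀ x, minPot μ (fun y => w y + -1 * v y) x = minPot μ w x - minPot μ v x := fun x => by
    rw [minPot_add hwi (hvi.const_mul _), minPot_const_mul]; ring
  set g : C(I, ℝ) := ⟨fun x => minPot μ (fun y => w y + -1 * v y) x,
    (continuous_iff_continuousAt.2 fun x =>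
        (hasDerivAt_minPot hdi x).continuousAt).comp continuous_subtype_val⟩ with hg
  refine ⟨boundaryCorrection b g, ?_, ?_⟩
  · refine IsPotential.mem_resolventClosure hd ?_
    cases b
    · refine ⟨0, 0, fun x => ?_, rfl, ?_⟩
      · rw [zero_mul, add_zero, zero_add]; rfl
      · rw [integral_add hwi (hvi.const_mul _), integral_const_mul, hv1, hw1]; norm_num
    · refine ⟨0, -g 1, fun x => ?_, ?_, ?_⟩
      · change g x - g 1 * x = 0 + -g 1 * x + g x
        ring
      · change minPot μ _ ((0 : I) : ℝ) - g 1 * ((0 : I) : ℝ) = 0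
        simp [minPot_zero]
      · change g 1 - g 1 * ((1 : I) : ℝ) = 0
        simp
  · rw [dist_eq_norm, ← map_sub]
    refine (norm_boundaryCorrection_le b _).trans_lt ?_
    have : ‖ramp p q - g‖ ≤ ε / 4 := by
      refine (ContinuousMap.norm_le _ (by linarith)).2 fun x => ?_
      have e : (ramp p q - g) x =
          -(minPot μ w x - min (x : ℝ) q) + (minPot μ v x - min (x : ℝ) p) := by
        change min (x : ℝ) q - min (x : ℝ) p - minPot μ (fun y => w y + -1 * v y) x = _
        rw [he]; ring
      rw [e, Real.norm_eq_abs]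
      refine (abs_add_le _ _).trans ?_
      rw [abs_neg]
      linarith [hwq x, hvp x]
    linarith

theorem one_mem_resolventClosure (μ : Measure I) [MassDistribution μ] :
    (1 : C(I, ℝ)) ∈ resolventClosure .neumann μ := by
  refine IsPotential.mem_resolventClosure (w := fun _ => 0) MemLp.zero
    ⟨1, 0, fun x => ?_, rfl, by simp⟩
  simp [minPot]

/-- The resolvent has dense range in the space of functions which are linear on the gaps of `supp μ`
and satisfy the boundary condition. -/
theorem gapSpace_le_resolventClosure : gapSpace b μ ≤ resolventClosure b μ := by
  rintro f ⟨hf, hb⟩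
  have hcl : IsClosed (resolventClosure b μ : Set C(I, ℝ)) :=
    Submodule.isClosed_topologicalClosure _
  rw [← SetLike.mem_coe, ← hcl.closure_eq, Metric.mem_closure_iff]
  intro ε hε
  obtain ⟨g, hgU, hg1, hfg⟩ := hf.exists_approx (U := (resolventClosure b μ).comap
    (boundaryCorrection b)) Measure.isClosed_support MassDistribution.zero_mem_support
    MassDistribution.one_mem_support (fun p hp q hq => boundaryCorrection_ramp_mem b μ hp hq)
    (show 0 < ε / 2 by linarith)
  -- The spline g approximates f - f 0. Under Neumann conditions constants are in the closure; under
  -- Dirichlet conditions f 0 = 0, and g 1 = f 1 - f 0 = 0 makes the correction of g trivial.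
  refine ⟨g + f 0 • 1, ?_, ?_⟩
  · cases b
    · exact Submodule.add_mem _ hgU (Submodule.smul_mem _ _ (one_mem_resolventClosure μ))
    · obtain ⟨h0, h1⟩ := hb rfl
      have e : boundaryCorrection .dirichlet g = g := by
        change g - g 1 • _ = g
        rw [hg1, h0, h1, sub_self, zero_smul, sub_zero]
      rw [Submodule.mem_comap, e] at hgU
      rw [h0, zero_smul, add_zero]
      exact hgU
  · rw [dist_eq_norm]
    refine lt_of_le_of_lt ((ContinuousMap.norm_le _ (by linarith)).2 fun x => ?_)
      (show ε / 2 < ε by linarith)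
    have e : (f - (g + f 0 • 1)) x = f x - f 0 - g x := by simp; ring
    rw [e]
    exact hfg x

end Density

/-! ### Generation of the semigroups and invariance of continuous classes -/

section Generation

variable (b : BoundaryCondition) (μ : Measure I) [MassDistribution μ]

/-- Continuous functions vanishing at the end points are dense in `L²`. -/
theorem dense_toL2_vanishing : Dense (toL2 μ '' {f | f 0 = 0 ∧ f 1 = 0}) := by
  set V : Submodule ℝ (L2 μ) := Submodule.map (toL2 μ).toLinearMap
    { carrier := {f : C(I, ℝ) | f 0 = 0 ∧ f 1 = 0}
      zero_mem' := by simp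
      add_mem' := by
        rintro f g ⟨h1, h2⟩ ⟨h3, h4⟩
        simp [h1, h2, h3, h4]
      smul_mem' := by
        rintro c f ⟨h1, h2⟩
        simp [h1, h2] } with hV
  suffices h : V.topologicalClosure = ⊤ by
    exact Submodule.dense_iff_topologicalClosure_eq_top.2 h
  rw [Submodule.topologicalClosure_eq_top_iff, Submodule.eq_bot_iff]
  intro h hh
  -- If h is orthogonal to every f q, then q h is orthogonal to all continuous functions, so q h =
  -- 0; q vanishes only at the end points, which are null.
  set q : C(I, ℝ) := ⟨fun x => x * (1 - x), by fun_prop⟩ with hq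
  have hm : MemLp (fun y => q y * h y) 2 μ := by
    refine (Lp.memLp h).of_le_mul (c := ‖q‖) (q.continuous.aestronglyMeasurable.mul
      (Lp.aestronglyMeasurable h)) (Eventually.of_forall fun y => ?_)
    rw [norm_mul]
    exact mul_le_mul_of_nonneg_right (q.norm_coe_le_norm y) (norm_nonneg _)
  have h0 : hm.toLp = 0 := by
    refine Dense.eq_zero_of_inner_left ℝ
      (ContinuousMap.toLp_denseRange ℝ μ ℝ (p := 2) (by norm_num)) ?_
    rintro _ ⟨f, rfl⟩
    have h1 : inner ℝ (toL2 μ (f * q)) h = 0 :=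
      hh _ (Submodule.mem_map_of_mem ⟨by simp [hq], by simp [hq]⟩)
    rw [inner_toL2] at h1
    rw [real_inner_comm]
    change inner ℝ (toL2 μ f) _ = 0
    rw [inner_toL2, ← h1]
    refine integral_congr_ae ?_
    filter_upwards [hm.coeFn_toLp] with y hy
    rw [hy, ContinuousMap.mul_apply]; ring
  refine Lp.ext ?_
  have h2 : ∀ᵐ y ∂μ, q y * h y = 0 := by
    filter_upwards [hm.coeFn_toLp, Lp.coeFn_zero ℝ 2 μ] with y h1 h2
    rw [← h1, h0, h2]; rfl
  filter_upwards [h2, ae_coe_ne (μ := μ) 0, ae_coe_ne (μ := μ) 1, Lp.coeFn_zero ℝ 2 μ]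
    with y h1 h3 h4 h5
  rw [h5, Pi.zero_apply]
  refine (mul_eq_zero.1 h1).resolve_left ?_
  exact mul_ne_zero h3 (sub_ne_zero.2 (Ne.symm h4))

theorem toL2_mem_closure_of_mem_gapSpace {f : C(I, ℝ)} (hf : f ∈ gapSpace b μ) :
    toL2 μ f ∈ closure (range ((resolventL2 b μ).R 1)) := by
  have h := gapSpace_le_resolventClosure b μ hf
  rw [← SetLike.mem_coe, coe_resolventClosure] at h
  refine closure_mono ?_ (image_closure_subset_closure_image (toL2 μ).continuous
    (mem_image_of_mem _ h))
  rintro _ ⟨_, ⟨g, rfl⟩, rfl⟩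
  exact ⟨toL2 μ g, rfl⟩

variable {b μ}

theorem linRep_mem_gapSpace (u : contSpace b μ) : linRep b μ u ∈ gapSpace b μ :=
  (linRep_spec b μ u).2

theorem toL2_linRep (u : contSpace b μ) : toL2 μ (linRep b μ u) = u :=
  Lp.ext ((coeFn_toL2 μ _).trans (linRep_spec b μ u).1.symm)

/-- The representative is unique, so the choice made in `linRep` is immaterial: continuous functions
equal almost everywhere agree on the support, and linearity on the gaps fixes the rest. -/
theorem linRep_eq {u : contSpace b μ} {f : C(I, ℝ)} (hf : f ∈ gapSpace b μ)
    (hu : toL2 μ f = u) : linRep b μ u = f := by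
  have h : (linRep b μ u : I → ℝ) =ᵐ[μ] f :=
    (linRep_spec b μ u).1.symm.trans (hu ▸ coeFn_toL2 μ f)
  exact DFunLike.coe_injective ((linRep_mem_gapSpace u).1.eq_of_eqOn Measure.isClosed_support
    MassDistribution.zero_mem_support MassDistribution.one_mem_support hf.1
    (eqOn_support_of_ae_eq (linRep b μ u).continuous f.continuous h))

theorem supNorm_le (u : contSpace b μ) : supNorm b μ u ≤ ‖linRep b μ u‖ := by
  have : Nonempty μ.support := ⟨⟨0, MassDistribution.zero_mem_support⟩⟩
  exact ciSup_le fun x => (linRep b μ u).norm_coe_le_norm x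

theorem supNorm_nonneg (u : contSpace b μ) : 0 ≤ supNorm b μ u :=
  Real.iSup_nonneg fun _ => abs_nonneg _

variable (b μ)

theorem denseRange_resolventL2 : DenseRange ((resolventL2 b μ).R 1) := by
  have h : toL2 μ '' {f | f 0 = 0 ∧ f 1 = 0} ⊆ closure (range ((resolventL2 b μ).R 1)) := by
    rintro _ ⟨f, hf, rfl⟩
    have hc : toL2 μ f ∈ contSpace b μ := ⟨f, coeFn_toL2 μ f, fun _ => hf⟩
    have := toL2_mem_closure_of_mem_gapSpace b μ (linRep_mem_gapSpace ⟨_, hc⟩)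
    rwa [toL2_linRep] at this
  rw [DenseRange, ← dense_closure]
  exact (dense_toL2_vanishing μ).mono h

theorem existsUnique_semigroup :
    ∃! T : StronglyContinuousSemigroup (L2 μ), T.generator = kreinFeller b μ := by
  obtain ⟨T, hT⟩ := (resolventL2 b μ).exists_semigroup (denseRange_resolventL2 b μ)
  have hgen : T.generator = kreinFeller b μ := by
    rw [ContractionResolvent.generator_eq (denseRange_resolventL2 b μ) hT, kreinFeller_eq_range]
  refine ⟨T, hgen, fun S hS => StronglyContinuousSemigroup.eq_of_generator_eq
    (hS.trans hgen.symm) ((denseRange_resolventL2 b μ).mono ?_)⟩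
  rintro _ ⟨y, rfl⟩
  exact ⟨_, hgen ▸ kreinFeller_eq_range b μ ▸ mem_range_self y⟩

variable {b μ}

theorem tendsto_yosida_of_generator_eq {T : StronglyContinuousSemigroup (L2 μ)}
    (hT : T.generator = kreinFeller b μ) (t : ℝ≥0) (u : L2 μ) :
    Tendsto (fun l : ℝ => (resolventL2 b μ).yosida l t u) atTop (𝓝 (T.op t u)) := by
  obtain ⟨S, hS⟩ := (resolventL2 b μ).exists_semigroup (denseRange_resolventL2 b μ)
  have hgen : S.generator = kreinFeller b μ := by
    rw [ContractionResolvent.generator_eq (denseRange_resolventL2 b μ) hS, kreinFeller_eq_range]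
  rw [(existsUnique_semigroup b μ).unique hT hgen]
  exact hS t u

theorem mem_closure_of_mem_gapSpace {f : C(I, ℝ)} (hf : f ∈ gapSpace b μ) :
    f ∈ closure (range ((resolventC b μ).R 1)) := by
  rw [← coe_resolventClosure]
  exact gapSpace_le_resolventClosure b μ hf

theorem yosida_mem_gapSpace {f : C(I, ℝ)} (hf : f ∈ gapSpace b μ) {l : ℝ} (hl : 0 < l) (t : ℝ) :
    (resolventC b μ).yosida l t f ∈ gapSpace b μ :=
  exp_apply_mem (isClosed_gapSpace b μ) (fun _ hg => Submodule.smul_mem _ _ (Submodule.sub_mem _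
    (Submodule.smul_mem _ _ (greenResolvent_mem_gapSpace b μ hl _)) (Submodule.smul_mem _ _ hg))) hf

/-- The Yosida approximations preserve the closed space `gapSpace`, and their sup-norm limit is also
their L² limit. Hence g is the gap-linear representative of T_t f. -/
theorem tendsto_yosida_spec {T : StronglyContinuousSemigroup (L2 μ)}
    (hT : T.generator = kreinFeller b μ) {f g : C(I, ℝ)} (hf : f ∈ gapSpace b μ) {t : ℝ≥0}
    (hg : Tendsto (fun l : ℝ => (resolventC b μ).yosida l t f) atTop (𝓝 g)) :
    g ∈ gapSpace b μ ∧ toL2 μ g = T.op t (toL2 μ f) := by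
  refine ⟨(isClosed_gapSpace b μ).mem_of_tendsto hg ?_, ?_⟩
  · filter_upwards [eventually_gt_atTop 0] with l hl using yosida_mem_gapSpace hf hl t
  · refine tendsto_nhds_unique (((toL2 μ).continuous.tendsto g).comp hg) ?_
    simp only [Function.comp_def, toL2_yosida]
    exact tendsto_yosida_of_generator_eq hT t _

/-- The semigroup leaves the space of continuous classes invariant. -/
theorem op_mem_contSpace {T : StronglyContinuousSemigroup (L2 μ)}
    (hT : T.generator = kreinFeller b μ) (t : ℝ≥0) (u : L2 μ) (hu : u ∈ contSpace b μ) :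
    T.op t u ∈ contSpace b μ := by
  have hf := linRep_mem_gapSpace ⟨u, hu⟩
  obtain ⟨g, hg⟩ := (resolventC b μ).exists_tendsto_yosida (mem_closure_of_mem_gapSpace hf) t.2
  obtain ⟨h1, h2⟩ := tendsto_yosida_spec hT hf hg
  rw [toL2_linRep] at h2
  exact ⟨g, h2 ▸ coeFn_toL2 μ g, h1.2⟩

end Generation

/-! ### Weak convergence of measures implies convergence of resolvents -/

section ResolventConvergence

theorem tendsto_of_lipschitz_of_pointwise {f : C(I, ℝ)} {fs : ℕ → C(I, ℝ)} {C : ℝ}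
    (hf : ∀ x y : I, |f x - f y| ≤ C * |(x : ℝ) - y|)
    (hfs : ∀ n, ∀ x y : I, |fs n x - fs n y| ≤ C * |(x : ℝ) - y|)
    (h : ∀ x, Tendsto (fun n => fs n x) atTop (𝓝 (f x))) : Tendsto fs atTop (𝓝 f) := by
  rw [Metric.tendsto_nhds]
  intro ε hε
  set D := |C| + 1
  have hD : 0 < D := by positivity
  have hCD : C ≤ D := (le_abs_self C).trans (by simp [D])
  obtain ⟨s, -, hs, hcov⟩ := finite_cover_balls_of_compact (isCompact_univ (X := I))
    (show 0 < ε / (8 * D) by positivity)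
  have hev : ∀ᶠ n in atTop, ∀ y ∈ s, dist (fs n y) (f y) < ε / 4 :=
    (eventually_all_finite hs).2 fun y _ => Metric.tendsto_nhds.1 (h y) _ (by linarith)
  filter_upwards [hev] with n hn
  refine lt_of_le_of_lt ((ContinuousMap.dist_le (by linarith)).2 fun x => ?_)
    (show ε / 2 < ε by linarith)
  obtain ⟨y, hy, hxy⟩ := mem_iUnion₂.1 (hcov (mem_univ x))
  have hxy' : |(x : ℝ) - y| < ε / (8 * D) := hxy
  have h1 : C * |(x : ℝ) - y| ≤ ε / 8 := by
    calc C * |(x : ℝ) - y| ≤ D * (ε / (8 * D)) := by gcongr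
      _ = ε / 8 := by field_simp
  have h2 := hn y hy
  have h3 := (hf x y).trans h1
  have h4 := (hfs n x y).trans h1
  rw [Real.dist_eq, abs_lt] at h2
  rw [Real.dist_eq]
  rw [abs_le] at h3 h4 ⊢
  constructor <;> linarith [h2.1, h2.2, h3.1, h3.2, h4.1, h4.2]

variable {b : BoundaryCondition} {μ : ProbabilityMeasure I} {μs : ℕ → ProbabilityMeasure I}

theorem tendsto_integral_of_tendsto (h : Tendsto μs atTop (𝓝 μ)) {f : I → ℝ} (hf : Continuous f) :
    Tendsto (fun n => ∫ x, f x ∂(μs n : Measure I)) atTop (𝓝 (∫ x, f x ∂(μ : Measure I))) :=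
  ProbabilityMeasure.tendsto_iff_forall_integral_tendsto.1 h
    (BoundedContinuousFunction.mkOfCompact ⟨f, hf⟩)

/-- The potential of a continuous density as a continuous function. -/
noncomputable def minPotC (μ : Measure I) [IsProbabilityMeasure μ] [NullSingletonClass μ]
    (w : C(I, ℝ)) : C(I, ℝ) :=
  ⟨fun x => minPot μ w x, (continuous_iff_continuousAt.2 fun x =>
    (hasDerivAt_minPot (integrable_coe_C w) x).continuousAt).comp continuous_subtype_val⟩

theorem minPotC_apply (μ : Measure I) [IsProbabilityMeasure μ] [NullSingletonClass μ]
    (w : C(I, ℝ)) (x : I) : minPotC μ w x = minPot μ w x := rfl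

variable [MassDistribution (μ : Measure I)] [∀ n, MassDistribution (μs n : Measure I)]

theorem tendsto_minPotC (h : Tendsto μs atTop (𝓝 μ)) (w : C(I, ℝ)) :
    Tendsto (fun n => minPotC (μs n : Measure I) w) atTop (𝓝 (minPotC (μ : Measure I) w)) := by
  have hlip : ∀ (ν : Measure I) [MassDistribution ν] (x y : I),
      |minPotC ν w x - minPotC ν w y| ≤ ‖w‖ * |(x : ℝ) - y| := by
    intro ν _ x y
    refine (abs_minPot_sub_le (integrable_coe_C w) x y).trans
      (mul_le_mul_of_nonneg_right ?_ (abs_nonneg _))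
    calc ∫ z, |w z| ∂ν ≤ ∫ _, ‖w‖ ∂ν := integral_mono (integrable_coe_C w).abs
          (integrable_const _) w.norm_coe_le_norm
      _ = ‖w‖ := by simp
  refine tendsto_of_lipschitz_of_pointwise (hlip _) (fun n => hlip _) fun x => ?_
  exact tendsto_integral_of_tendsto h (by fun_prop)

/-- Potentials with respect to `μ` are limits of potentials with respect to `μs n`. -/
theorem IsPotential.exists_tendsto (h : Tendsto μs atTop (𝓝 μ)) {w f : C(I, ℝ)}
    (hf : IsPotential b (μ : Measure I) w f) : ∃ (g : ℕ → C(I, ℝ)) (e : ℕ → ℝ),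
    (∀ n, IsPotential b (μs n : Measure I) (fun y => w y - e n) (g n)) ∧
    Tendsto g atTop (𝓝 f) ∧ Tendsto e atTop (𝓝 0) := by
  obtain ⟨α, β, h1, h2⟩ := hf
  have hw := tendsto_minPotC h w
  cases b
  · have he : Tendsto (fun n => ∫ y, w y ∂(μs n : Measure I)) atTop (𝓝 0) :=
      h2.2 ▸ tendsto_integral_of_tendsto h w.continuous
    -- A Neumann density needs mean zero, which w has for μ but perhaps not for μs n; its mean e n
    -- is subtracted and tends to 0 by weak convergence.
    refine ⟨fun n => α • (1 : C(I, ℝ)) + minPotC (μs n) w -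
      (∫ y, w y ∂(μs n : Measure I)) • minPotC (μs n) 1, fun n => ∫ y, w y ∂(μs n : Measure I),
      fun n => ⟨α, 0, fun x => ?_, rfl, ?_⟩, ?_, he⟩
    · set m := ∫ y, w y ∂(μs n : Measure I)
      have : minPot (μs n : Measure I) (fun y => w y - m) x =
          minPotC (μs n) w x - m * minPotC (μs n) 1 x := by
        have e : (fun y => w y - m) = fun y => w y + -m * (1 : C(I, ℝ)) y := by
          funext y; simp; ring
        rw [e, minPot_add (integrable_coe_C w) ((integrable_coe_C 1).const_mul _),
          minPot_const_mul, minPotC_apply, minPotC_apply]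
        ring
      rw [this]
      simp
      ring
    · rw [integral_sub (integrable_coe_C w) (integrable_const _)]
      simp
    · have e : f = α • (1 : C(I, ℝ)) + minPotC (μ : Measure I) w -
          (0 : ℝ) • minPotC (μ : Measure I) 1 := by
        ext x
        rw [h1, h2.1]; simp [minPotC_apply]
      rw [e]
      exact (hw.const_add _).sub (he.smul (tendsto_minPotC h 1))
  · set idC : C(I, ℝ) := ⟨fun x => x, continuous_subtype_val⟩
    refine ⟨fun n => minPotC (μs n) w - minPotC (μs n) w 1 • idC, fun _ => 0, fun n =>
      ⟨0, -minPotC (μs n) w 1, fun x => ?_, ?_, ?_⟩, ?_, tendsto_const_nhds⟩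
    · simp only [sub_zero]
      change minPotC (μs n) w x - minPotC (μs n) w 1 * x =
        0 + -minPotC (μs n) w 1 * x + minPotC (μs n) w x
      ring
    · change minPot _ _ ((0 : I) : ℝ) - minPotC (μs n) w 1 * ((0 : I) : ℝ) = 0
      simp [minPot_zero]
    · change minPotC (μs n) w 1 - minPotC (μs n) w 1 * ((1 : I) : ℝ) = 0
      simp
    · have e : f = minPotC (μ : Measure I) w - minPotC (μ : Measure I) w 1 • idC := by
        have hα := h1 0
        have hβ := h1 1
        rw [h2.1] at hα
        rw [h2.2] at hβ
        simp only [Set.Icc.coe_zero, Set.Icc.coe_one, minPot_zero, mul_zero, mul_one, add_zero]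
          at hα hβ
        ext x
        rw [h1]
        change α + β * x + minPot (μ : Measure I) w x =
          minPot (μ : Measure I) w x - minPot (μ : Measure I) w ((1 : I) : ℝ) * x
        rw [Set.Icc.coe_one]
        linear_combination (-1 : ℝ) * hα * (1 - (x : ℝ)) - hβ * x
      rw [e]
      exact hw.sub (((continuous_eval_const (1 : I)).tendsto _ |>.comp hw).smul_const _)

/-- Weak convergence of measures implies strong convergence of the resolvents. -/
theorem tendsto_resolventC (h : Tendsto μs atTop (𝓝 μ)) {l : ℝ} (hl : 0 < l) (k : C(I, ℝ)) :
    Tendsto (fun n => (resolventC b (μs n : Measure I)).R l k) atTop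
      (𝓝 ((resolventC b (μ : Measure I)).R l k)) := by
  have hspec : ∀ (ν : Measure I) [MassDistribution ν],
      IsPotential b ν (k - l • (resolventC b ν).R l k : C(I, ℝ)) ((resolventC b ν).R l k) := by
    intro ν _
    refine (greenResolvent_spec b ν hl (toL2 ν k)).congr ?_
    filter_upwards [coeFn_toL2 ν k] with y hy
    rw [hy]; rfl
  set f := (resolventC b (μ : Measure I)).R l k
  obtain ⟨g, e, hg, hgf, he⟩ := (hspec (μ : Measure I)).exists_tendsto h
  have hd : Tendsto (fun n => l • (f - g n) + e n • (1 : C(I, ℝ))) atTop (𝓝 0) := by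
    have := ((hgf.const_sub f).const_smul l).add (he.smul_const (1 : C(I, ℝ)))
    rwa [sub_self, smul_zero, zero_smul, add_zero] at this
  -- The difference of the resolvent and g n solves the resolvent equation for μs n with right side
  -- l (f - g n) + e n, so the sup-norm contraction bound, uniform in n, makes it small.
  have hr : Tendsto (fun n => (resolventC b (μs n : Measure I)).R l k - g n) atTop (𝓝 0) := by
    refine squeeze_zero_norm (a := fun n => l⁻¹ * ‖l • (f - g n) + e n • (1 : C(I, ℝ))‖)
      (fun n => ?_) (by simpa using hd.norm.const_mul l⁻¹)
    rw [← div_eq_inv_mul, le_div_iff₀ hl, mul_comm]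
    set r := (resolventC b (μs n : Measure I)).R l k
    have h2 := (hspec (μs n : Measure I)).add (integrable_coe_C _)
      (((integrable_coe_C _).sub (integrable_const (e n))).const_mul (-1)) ((hg n).const_mul (-1))
    refine IsPotential.mul_norm_le (b := b) (μ := (μs n : Measure I)) hl ?_
    convert h2 using 1
    · funext y; simp [f, r]; ring
    · funext y; simp [r]; ring
  simpa using hr.add hgf

end ResolventConvergence

theorem theorem1p2 (b : BoundaryCondition)
    (μ : ProbabilityMeasure I) (μn : ℕ → ProbabilityMeasure I)
    [MassDistribution (μ : Measure I)] [∀ n, MassDistribution (μn n : Measure I)]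
    (hconv : Tendsto μn atTop (𝓝 μ))
    (hsupp : ∀ n, (μ : Measure I).support ⊆ (μn n : Measure I).support) :
    -- each Krein–Feller operator generates exactly one strongly continuous semigroup on `L²`
    (∃! T : StronglyContinuousSemigroup (L2 (μ : Measure I)), T.generator = kreinFeller b μ) ∧
    (∀ n, ∃! T : StronglyContinuousSemigroup (L2 (μn n : Measure I)),
      T.generator = kreinFeller b (μn n)) ∧
    -- these semigroups leave the spaces of continuous classes invariant, and the restricted
    -- semigroups converge strongly, uniformly on bounded time intervals
    ∀ (T : StronglyContinuousSemigroup (L2 (μ : Measure I)))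
      (Tn : ∀ n, StronglyContinuousSemigroup (L2 (μn n : Measure I))),
      T.generator = kreinFeller b μ →
      (∀ n, (Tn n).generator = kreinFeller b (μn n)) →
      ∃ (hT : ∀ (t : ℝ≥0), ∀ u ∈ contSpace b (μ : Measure I),
          T.op t u ∈ contSpace b (μ : Measure I))
        (hTn : ∀ (n : ℕ) (t : ℝ≥0), ∀ u ∈ contSpace b (μn n : Measure I),
          (Tn n).op t u ∈ contSpace b (μn n : Measure I)),
        ∀ (f : contSpace b (μ : Measure I)) (S : ℝ≥0),
          TendstoUniformlyOn
            (fun (n : ℕ) (t : ℝ≥0) =>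
              supNorm b (μn n : Measure I)
                (embed b (μ : Measure I) (μn n : Measure I) (T.restrict _ hT t f) -
                  (Tn n).restrict _ (hTn n) t (embed b (μ : Measure I) (μn n : Measure I) f)))
            (fun _ => 0) atTop (Iic S) := by
  refine ⟨existsUnique_semigroup b _, fun n => existsUnique_semigroup b _, fun T Tn hgen hgenn =>
    ⟨op_mem_contSpace hgen, fun n => op_mem_contSpace (hgenn n), fun f S => ?_⟩⟩
  set F := linRep b (μ : Measure I) f with hF
  have hFμ : F ∈ gapSpace b (μ : Measure I) := linRep_mem_gapSpace f
  -- Inclusion of the supports lets F start all the approximating semigroups at once.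
  have hmono : ∀ n, gapSpace b (μ : Measure I) ≤ gapSpace b (μn n : Measure I) :=
    fun n g hg => ⟨hg.1.mono (hsupp n), hg.2⟩
  choose! y hy using fun (t : ℝ) (ht : 0 ≤ t) =>
    (resolventC b (μ : Measure I)).exists_tendsto_yosida (mem_closure_of_mem_gapSpace hFμ) ht
  choose! yn hyn using fun (n : ℕ) (t : ℝ) (ht : 0 ≤ t) =>
    (resolventC b (μn n : Measure I)).exists_tendsto_yosida
      (mem_closure_of_mem_gapSpace (hmono n hFμ)) ht
  have hlim := fun (ε : ℝ) (hε : 0 < ε) =>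
    (resolventC b (μ : Measure I)).eventually_norm_limit_sub_lt
      (𝓡s := fun n => resolventC b (μn n : Measure I))
      (fun l hl => tendsto_resolventC hconv hl) (mem_closure_of_mem_gapSpace hFμ) S hy hyn hε
  rw [Metric.tendstoUniformlyOn_iff]
  intro ε hε
  filter_upwards [hlim ε hε] with n hn t ht
  rw [dist_comm, Real.dist_eq, sub_zero, abs_of_nonneg (supNorm_nonneg _)]
  refine ((supNorm_le _).trans_eq ?_).trans_lt (hn t ⟨t.2, ht⟩)
  obtain ⟨hy1, hy2⟩ := tendsto_yosida_spec hgen hFμ (hy t t.2)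
  obtain ⟨hz1, hz2⟩ := tendsto_yosida_spec (hgenn n) (hmono n hFμ) (hyn n t t.2)
  have e1 : linRep b (μ : Measure I) (T.restrict _ (op_mem_contSpace hgen) t f) = y t := by
    refine linRep_eq hy1 (hy2.trans ?_)
    rw [toL2_linRep]; rfl
  -- The gap-linear representative of the difference is y t - yn n t: embedding does not change the
  -- function y t, which already belongs to the larger gap space.
  rw [linRep_eq (f := y t - yn n t) (Submodule.sub_mem _ (hmono n hy1) hz1)]
  rw [map_sub, hz2]
  change _ = toL2 _ (linRep b (μ : Measure I) _) - (Tn n).op t (toL2 _ (linRep b (μ : Measure I) f))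
  rw [e1]
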